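/- **Notation.** Identify $\mathbb H^n$ with $\mathbb R^{4n}$ by $q_l=x_{4l}+\mathbf i x_{4l+1}+\mathbf j x_{4l+2}+\mathbf k x_{4l+3}$, let $\omega^0,\dots,\omega^{2n-1}$ be the standard basis of $\mathbb C^{2n}$, and put $$\begin{pmatrix}\nabla_{(2l)0}&\nabla_{(2l)1}\\ \nabla_{(2l+1)0}&\nabla_{(2l+1)1}\end{pmatrix}=\begin{pmatrix}\partial_{x_{4l}}+\mathbf i\partial_{x_{4l+1}}&-\partial_{x_{4l+2}}-\mathbf i\partial_{x_{4l+3}}\\ \partial_{x_{4l+2}}-\mathbf i\partial_{x_{4l+3}}&\partial_{x_{4l}}-\mathbf i\partial_{x_{4l+1}}\end{pmatrix},\qquad 0\le l<n.$$ For $F=\sum_I f_I\omega^I$ with values in $\wedge^k\mathbb C^{2n}$ let $d_\alpha F=\sum_{j,I}\nabla_{j\alpha}f_I\,\omega^j\wedge\omega^I$ ($\alpha=0,1$) and $\triangle F=d_0d_1F$; let $\beta_n=\sum_{l=0}^{n-1}\omega^{2l}\wedge\omega^{2l+1}$. For a right $\mathbb H$-linear map $\eta:\mathbb H^n\to\mathbb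 H$, $\eta(q)=\sum_l\eta_lq_l$, and $s=0,1$ let $\eta^*\widetilde\omega^s=\sum_{l}\sum_{t=0,1}\tau(\eta_l)_{st}\,\omega^{2l+t}$, where $\tau(a_0+\mathbf ia_1+\mathbf ja_2+\mathbf ka_3)=\begin{pmatrix}a_0-\mathbf ia_1&-a_2+\mathbf ia_3\\a_2+\mathbf ia_3&a_0+\mathbf ia_1\end{pmatrix}$. A $2k$-element is *strongly positive* if it is a finite combination with nonnegative coefficients of elements $\eta_1^*\widetilde\omega^0\wedge\eta_1^*\widetilde\omega^1\wedge\dots\wedge\eta_k^*\widetilde\omega^0\wedge\eta_k^*\widetilde\omega^1$ with $\eta_1,\dots,\eta_k$ linearly independent. Let $\Omega\subseteq\mathbb H^n$ be open. A *$(2n-k)$-current* on $\Omega$ is a continuous linear functional $T$ on the space of test $k$-forms $C_0^\infty(\Omega,\wedge^{k}\mathbb C^{2n})$. It is *closed* if $T(d_0\eta)=T(d_1\eta)=0$ for all test $(k-1)$-forms $\eta$; a $(2n-2p)$-current is *positive* if $T(\eta)\ge0$ for every test $2p$-form $\eta$ with strongly positive values. For a smooth $k$-form $\psi$ on an open set $U\subseteq\Omega$,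 $T\wedge\psi$ is the distribution $\varphi\mapsto T(\varphi\psi)$ on $U$; if it is given by a positive Radon measure $\mu$ on $U$, put $\int_B T\wedge\psi:=\mu(B)$ for Borel sets $B\subseteq U$. **Proposition.** Let $0\le p\le n$, $a\in\Omega$, $R>0$, $\overline{B(a,R)}\subseteq\Omega$, and let $T$ be a closed positive $(2n-2p)$-current on $\Omega$. Then $T\wedge\beta_n^p$ on $\Omega$ and $T\wedge\big(\triangle(-\|q-a\|^{-2})\big)^p$ on $\Omega\setminus\{a\}$ are given by positive Radon measures, and with $$\sigma_T(a,r):=\int_{B(a,r)}T\wedge\beta_n^p$$ one has, for all $0<r_1<r_2<R$, $$\int_{B(a,r_2)\setminus B(a,r_1)}T\wedge\big(\triangle(-\|q-a\|^{-2})\big)^p=8^p\left(\frac{\sigma_T(a,r_2)}{r_2^{4p}}-\frac{\sigma_T(a,r_1)}{r_1^{4p}}\right)$$ and $$\int_{B(a,r_2)\setminus\overline B(a,r_1)}T\wedge\big(\triangle(-\|q-a\|^{-2})\big)^p=8^p\left(\frac{\sigma_T(a,r_2)}{r_2^{4p}}-\frac{1}{r_1^{4p}}\int_{\overline B(a,r_1)}T\wedge\beta_n^p\right);$$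 in particular, the left side of the second formula is $8^p\big(\sigma_T(a,r_2)r_2^{-4p}-\sigma_T(a,r_1)r_1^{-4p}\big)$ whenever $T\wedge\beta_n^p$ has no mass on the sphere $\|q-a\|=r_1$. Hence $r\mapsto r^{-4p}\sigma_T(a,r)$ is nondecreasing on $(0,R)$, and the Lelong number $$\nu_a(T):=\lim_{r\to0+}\frac{\sigma_T(a,r)}{r^{4p}}$$ exists (as a real number) and is nonnegative. -/

import Mathlib

open Set Filter Topology MeasureTheory TopologicalSpace Metric
open scoped ContDiff Distributions Quaternion

noncomputable section

namespace QCurrent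

/-! ### The space `ℍⁿ ≅ ℝ⁴ⁿ` and the exterior algebra of `ℂ²ⁿ` -/

/-- `ℍⁿ ≅ ℝ⁴ⁿ` with the Euclidean norm; the coordinate `x (l, i)` is the real coordinate
`x_{4l+i}`, so that `q_l = x (l,0) + x (l,1) 𝐢 + x (l,2) 𝐣 + x (l,3) 𝐤`. -/
abbrev H (n : ℕ) : Type := EuclideanSpace ℝ (Fin n × Fin 4)

/-- The indices `0, …, 2n-1` of the basis `ω⁰, …, ω²ⁿ⁻¹` of `ℂ²ⁿ`; the pair `(l, s)` stands for
`2l+s`. -/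
abbrev Idx (n : ℕ) : Type := Fin n ×ₗ Fin 2

/-- The complex exterior algebra of `ℂ²ⁿ`; the product of this algebra is the wedge product. -/
def Lam (n : ℕ) : Type := ExteriorAlgebra ℂ (Idx n → ℂ)

instance instRingLam (n : ℕ) : Ring (Lam n) :=
  inferInstanceAs (Ring (ExteriorAlgebra ℂ (Idx n → ℂ)))

instance instAlgebraLam (n : ℕ) : Algebra ℂ (Lam n) :=
  inferInstanceAs (Algebra ℂ (ExteriorAlgebra ℂ (Idx n → ℂ)))

/-- The basis of the exterior algebra that consists of the products
`ω^I = ω^{i₁} ∧ … ∧ ω^{i_k}`, `i₁ < … < i_k`. -/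
def lamBasis (n : ℕ) : Module.Basis (Finset (Idx n)) ℂ (Lam n) :=
  (Pi.basisFun ℂ (Idx n)).ExteriorAlgebra

/-- The exterior algebra is normed by the largest modulus of a coefficient. -/
instance instNormedAddCommGroupLam (n : ℕ) : NormedAddCommGroup (Lam n) :=
  NormedAddCommGroup.induced (Lam n) (Finset (Idx n) → ℂ) (lamBasis n).equivFun
    (lamBasis n).equivFun.injective

instance instNormedSpaceLam (n : ℕ) : NormedSpace ℂ (Lam n) :=
  NormedSpace.induced ℂ (Lam n) (Finset (Idx n) → ℂ) (lamBasis n).equivFun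

instance instFiniteLam (n : ℕ) : FiniteDimensional ℂ (Lam n) :=
  Module.Basis.finiteDimensional_of_finite (lamBasis n)

/-- The basis vector `ω^j` of `ℂ²ⁿ`. -/
def om {n : ℕ} (j : Idx n) : Lam n :=
  ExteriorAlgebra.ι ℂ (Pi.single j (1 : ℂ) : Idx n → ℂ)

/-- `∧ᵏ ℂ²ⁿ`. -/
def deg (n k : ℕ) : Submodule ℂ (Lam n) :=
  (ExteriorAlgebra.exteriorPower ℂ k (Idx n → ℂ) :
    Submodule ℂ (ExteriorAlgebra ℂ (Idx n → ℂ)))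

/-- `β_n = ∑_l ω^{2l} ∧ ω^{2l+1}`. -/
def beta (n : ℕ) : Lam n :=
  ∑ l : Fin n, om (toLex (l, 0)) * om (toLex (l, 1))

/-! ### Strongly positive elements -/

/-- The embedding `τ : ℍ → ℂ^{2×2}`. -/
def tau (a : ℍ[ℝ]) : Matrix (Fin 2) (Fin 2) ℂ :=
  !![(a.re : ℂ) - Complex.I * a.imI, -(a.imJ : ℂ) + Complex.I * a.imK;
     (a.imJ : ℂ) + Complex.I * a.imK, (a.re : ℂ) + Complex.I * a.imI]

/-- For the right `ℍ`-linear map `η : ℍⁿ → ℍ`, `η(q) = ∑_l η_l q_l`, with row `(η_l)`, the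
pull-back `η^* ω̃^s = ∑_j τ(η)_{sj} ω^j` of the element `ω̃^s` of the standard basis of `ℂ²`. -/
def pullback {n : ℕ} (η : Fin n → ℍ[ℝ]) (s : Fin 2) : Lam n :=
  ∑ l : Fin n, ∑ t : Fin 2, tau (η l) s t • om (toLex (l, t))

/-- Elementary strongly positive `2k`-elements
`η_1^*ω̃⁰ ∧ η_1^*ω̃¹ ∧ … ∧ η_k^*ω̃⁰ ∧ η_k^*ω̃¹`, with `η_1, …, η_k` linearly independent right
`ℍ`-linear maps `ℍⁿ → ℍ` (which form a left `ℍ`-module). -/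
def IsElementary {n : ℕ} (k : ℕ) (ξ : Lam n) : Prop :=
  ∃ η : Fin k → Fin n → ℍ[ℝ], LinearIndependent ℍ[ℝ] η ∧
    ξ = (List.ofFn fun i : Fin k => pullback (η i) 0 * pullback (η i) 1).prod

/-- `SP^{2k} ℂ²ⁿ`, the convex cone generated by the elementary strongly positive `2k`-elements. -/
def SP (n k : ℕ) : Set (Lam n) :=
  {w | ∃ (m : ℕ) (c : Fin m → ℝ) (ξ : Fin m → Lam n),
    (∀ i, 0 ≤ c i) ∧ (∀ i, IsElementary k (ξ i)) ∧ w = ∑ i, (c i : ℂ) • ξ i}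

/-! ### The operators `d₀`, `d₁` and `△` -/

/-- The partial derivative `∂F/∂x_{4l+i}`. -/
def partialD {n : ℕ} (l : Fin n) (i : Fin 4) (F : H n → Lam n) (q : H n) : Lam n :=
  fderiv ℝ F q (EuclideanSpace.single (l, i) (1 : ℝ))

/-- The operator `∇_{jα}`, `j = 2l+s`. -/
def nabla {n : ℕ} (l : Fin n) (s α : Fin 2) (F : H n → Lam n) (q : H n) : Lam n :=
  !![partialD l 0 F q + Complex.I • partialD l 1 F q,
       -partialD l 2 F q - Complex.I • partialD l 3 F q;
     partialD l 2 F q - Complex.I • partialD l 3 F q,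
       partialD l 0 F q - Complex.I • partialD l 1 F q] s α

/-- `d_α F = ∑_j ω^j ∧ ∇_{jα} F`. -/
def d {n : ℕ} (α : Fin 2) (F : H n → Lam n) (q : H n) : Lam n :=
  ∑ l : Fin n, ∑ s : Fin 2, om (toLex (l, s)) * nabla l s α F q

/-- The Baston operator `△ u = d₀ d₁ u` on real functions. -/
def baston {n : ℕ} (u : H n → ℝ) : H n → Lam n :=
  d 0 (d 1 fun q => algebraMap ℂ (Lam n) (u q : ℂ))

/-! ### Smooth forms and test forms -/

/-- `ψ` is a smooth `k`-form on `U`. -/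
def IsSmoothForm {n : ℕ} (U : Set (H n)) (k : ℕ) (ψ : H n → Lam n) : Prop :=
  ContDiffOn ℝ ∞ ψ U ∧ ∀ q ∈ U, ψ q ∈ deg n k

/-- The test `k`-forms on `Ω`, i.e. `C_0^∞(Ω, ∧ᵏ ℂ²ⁿ)`. -/
abbrev TestForm {n : ℕ} (Ω : Opens (H n)) (k : ℕ) : Type := 𝓓(Ω, deg n k)

theorem exists_proj (n k : ℕ) :
    ∃ P : Lam n →L[ℝ] deg n k, ∀ w : deg n k, P (w : Lam n) = w := by
  obtain ⟨P, hP⟩ := LinearMap.exists_leftInverse_of_injective (deg n k).subtype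
    (Submodule.ker_subtype _)
  exact ⟨(LinearMap.toContinuousLinearMap P).restrictScalars ℝ,
    fun w => by simpa using LinearMap.congr_fun hP w⟩

theorem fderiv_mem_deg {n k : ℕ} {F : H n → Lam n} {q : H n}
    (hF : ∀ᶠ y in 𝓝 q, F y ∈ deg n k) (v : H n) : fderiv ℝ F q v ∈ deg n k := by
  by_cases hd : DifferentiableAt ℝ F q
  · obtain ⟨P, hP⟩ := exists_proj n k
    let J : deg n k →L[ℝ] Lam n := (deg n k).subtypeL.restrictScalars ℝ
    have h1 : F =ᶠ[𝓝 q] fun y => (J.comp P) (F y) := by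
      filter_upwards [hF] with y hy
      have := hP ⟨F y, hy⟩
      simp only at this
      simp [J, this]
    have h2 : fderiv ℝ F q = (J.comp P).comp (fderiv ℝ F q) := by
      conv_lhs => rw [h1.fderiv_eq]
      exact ((J.comp P).hasFDerivAt.comp q hd.hasFDerivAt).fderiv
    rw [h2]
    exact (P (fderiv ℝ F q v)).2
  · rw [fderiv_zero_of_not_differentiableAt hd]
    exact (deg n k).zero_mem

theorem om_mem {n : ℕ} (j : Idx n) : om j ∈ deg n 1 := by
  change ExteriorAlgebra.ι ℂ (Pi.single j (1 : ℂ) : Idx n → ℂ) ∈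
    (LinearMap.range (ExteriorAlgebra.ι ℂ : (Idx n → ℂ) →ₗ[ℂ] _)) ^ 1
  rw [pow_one]
  exact LinearMap.mem_range_self _ _

theorem mul_mem_deg {n i j : ℕ} {x y : Lam n} (hx : x ∈ deg n i) (hy : y ∈ deg n j) :
    x * y ∈ deg n (i + j) := by
  have h := Submodule.mul_mem_mul (M := ExteriorAlgebra.exteriorPower ℂ i (Idx n → ℂ))
    (N := ExteriorAlgebra.exteriorPower ℂ j (Idx n → ℂ)) hx hy
  rw [ExteriorAlgebra.exteriorPower, ExteriorAlgebra.exteriorPower, ← pow_add] at h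
  exact h

theorem pow_mem_deg {n i : ℕ} {x : Lam n} (hx : x ∈ deg n i) (p : ℕ) :
    x ^ p ∈ deg n (i * p) := by
  induction p with
  | zero =>
    rw [pow_zero]
    change (1 : ExteriorAlgebra ℂ (Idx n → ℂ)) ∈
      (LinearMap.range (ExteriorAlgebra.ι ℂ : (Idx n → ℂ) →ₗ[ℂ] _)) ^ 0
    rw [pow_zero]
    exact Submodule.one_le.1 le_rfl
  | succ p ih =>
    rw [pow_succ, Nat.mul_succ]
    exact mul_mem_deg ih hx

theorem algebraMap_mem_deg {n : ℕ} (c : ℂ) : algebraMap ℂ (Lam n) c ∈ deg n 0 := by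
  rw [Algebra.algebraMap_eq_smul_one]
  refine (deg n 0).smul_mem c ?_
  have := pow_mem_deg (n := n) (deg n 0).zero_mem 0
  simpa using this

theorem contDiffOn_mul {n : ℕ} {U : Set (H n)} {F G : H n → Lam n}
    (hF : ContDiffOn ℝ ∞ F U) (hG : ContDiffOn ℝ ∞ G U) :
    ContDiffOn ℝ ∞ (fun q => F q * G q) U := by
  let B₁ : Lam n →ₗ[ℂ] (Lam n →L[ℂ] Lam n) :=
    (LinearMap.toContinuousLinearMap : (Lam n →ₗ[ℂ] Lam n) ≃ₗ[ℂ] _).toLinearMap ∘ₗ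
      LinearMap.mul ℂ (Lam n)
  have hb : IsBoundedBilinearMap ℂ fun x : Lam n × Lam n => x.1 * x.2 :=
    (LinearMap.toContinuousLinearMap B₁).isBoundedBilinearMap
  have hc : ContDiff ℝ ∞ fun x : Lam n × Lam n => x.1 * x.2 :=
    (hb.contDiff (n := ∞)).restrict_scalars ℝ
  exact hc.comp_contDiffOn (hF.prodMk hG)

theorem contDiffOn_d {n : ℕ} {U : Set (H n)} (hU : IsOpen U) (α : Fin 2) {F : H n → Lam n}
    (hF : ContDiffOn ℝ ∞ F U) : ContDiffOn ℝ ∞ (d α F) U := by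
  have hp : ∀ (l : Fin n) (i : Fin 4), ContDiffOn ℝ ∞ (partialD l i F) U := fun l i =>
    (hF.fderiv_of_isOpen hU (by simp)).clm_apply contDiffOn_const
  have hI : ∀ G : H n → Lam n, ContDiffOn ℝ ∞ G U →
      ContDiffOn ℝ ∞ (fun q => Complex.I • G q) U := fun G hG => hG.const_smul Complex.I
  refine ContDiffOn.sum fun l _ => ContDiffOn.sum fun s _ => contDiffOn_mul contDiffOn_const ?_
  fin_cases s <;> fin_cases α
  · exact (hp l 0).add (hI _ (hp l 1))
  · exact (hp l 2).neg.sub (hI _ (hp l 3))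
  · exact (hp l 2).sub (hI _ (hp l 3))
  · exact (hp l 0).sub (hI _ (hp l 1))

theorem d_mem_deg {n k : ℕ} {F : H n → Lam n} {q : H n} (α : Fin 2)
    (hF : ∀ᶠ y in 𝓝 q, F y ∈ deg n k) : d α F q ∈ deg n (k + 1) := by
  have hp : ∀ (l : Fin n) (i : Fin 4), partialD l i F q ∈ deg n k := fun l i =>
    fderiv_mem_deg hF _
  have hI : ∀ x ∈ deg n k, Complex.I • x ∈ deg n k := fun x hx => (deg n k).smul_mem _ hx
  refine Submodule.sum_mem _ fun l _ => Submodule.sum_mem _ fun s _ => ?_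
  rw [add_comm k 1]
  refine mul_mem_deg (om_mem _) ?_
  fin_cases s <;> fin_cases α
  · exact (deg n k).add_mem (hp l 0) (hI _ (hp l 1))
  · exact (deg n k).sub_mem ((deg n k).neg_mem (hp l 2)) (hI _ (hp l 3))
  · exact (deg n k).sub_mem (hp l 2) (hI _ (hp l 3))
  · exact (deg n k).sub_mem (hp l 0) (hI _ (hp l 1))

theorem isSmoothForm_d {n k : ℕ} {U : Set (H n)} (hU : IsOpen U) (α : Fin 2) {F : H n → Lam n}
    (hF : IsSmoothForm U k F) : IsSmoothForm U (k + 1) (d α F) :=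
  ⟨contDiffOn_d hU α hF.1,
    fun _ hq => d_mem_deg α (Filter.eventually_of_mem (hU.mem_nhds hq) hF.2)⟩

theorem isSmoothForm_pow {n k : ℕ} {U : Set (H n)} {F : H n → Lam n}
    (hF : IsSmoothForm U k F) (p : ℕ) : IsSmoothForm U (k * p) (fun q => F q ^ p) := by
  refine ⟨?_, fun q hq => pow_mem_deg (hF.2 q hq) p⟩
  induction p with
  | zero => simpa using contDiffOn_const
  | succ p ih =>
    simp only [pow_succ]
    exact contDiffOn_mul ih hF.1

theorem isSmoothForm_beta_pow {n : ℕ} (U : Set (H n)) (p : ℕ) :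
    IsSmoothForm U (2 * p) (fun _ : H n => beta n ^ p) :=
  isSmoothForm_pow ⟨contDiffOn_const, fun _ _ => Submodule.sum_mem _ fun _ _ =>
    mul_mem_deg (om_mem _) (om_mem _)⟩ p

theorem isSmoothForm_baston_pow {n : ℕ} {U : Set (H n)} (hU : IsOpen U) {u : H n → ℝ}
    (hu : ContDiffOn ℝ ∞ u U) (p : ℕ) :
    IsSmoothForm U (2 * p) (fun q => baston u q ^ p) := by
  refine isSmoothForm_pow (isSmoothForm_d hU 0 (isSmoothForm_d hU 1 ⟨?_, ?_⟩)) p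
  · let A : ℂ →L[ℝ] Lam n :=
      (LinearMap.toContinuousLinearMap (Algebra.linearMap ℂ (Lam n))).restrictScalars ℝ
    exact (A.comp Complex.ofRealCLM).contDiff.comp_contDiffOn hu
  · exact fun q _ => algebraMap_mem_deg _

/-- A smooth compactly supported function with support in `Ω` and values in `∧ᵏ ℂ²ⁿ`, as a test
form. -/
def mkTestForm {n k : ℕ} {Ω : Opens (H n)} (F : H n → Lam n) (hs : ContDiff ℝ ∞ F)
    (hc : HasCompactSupport F) (hΩ : tsupport F ⊆ Ω) (hk : ∀ q, F q ∈ deg n k) :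
    TestForm Ω k where
  toFun q := ⟨F q, hk q⟩
  contDiff' := by
    obtain ⟨P, hP⟩ := exists_proj n k
    have : (fun q => (⟨F q, hk q⟩ : deg n k)) = fun q => P (F q) := by
      funext q
      exact (hP ⟨F q, hk q⟩).symm
    rw [this]
    exact P.contDiff.comp hs
  hasCompactSupport' := by
    refine hc.mono fun q hq => ?_
    intro h0
    exact hq (Subtype.ext h0)
  tsupport_subset' := by
    refine (closure_mono fun q hq => ?_).trans hΩ
    intro h0
    exact hq (Subtype.ext h0)

theorem contDiff_coe {n k : ℕ} {Ω : Opens (H n)} (η : TestForm Ω k) :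
    ContDiff ℝ ∞ fun q => (η q : Lam n) :=
  ((deg n k).subtypeL.restrictScalars ℝ).contDiff.comp η.contDiff

theorem tsupport_coe {n k : ℕ} {Ω : Opens (H n)} (η : TestForm Ω k) :
    tsupport (fun q => (η q : Lam n)) ⊆ tsupport η :=
  closure_mono fun _ hq h0 => hq (congrArg Subtype.val h0)

theorem tsupport_d {n : ℕ} (α : Fin 2) (F : H n → Lam n) : tsupport (d α F) ⊆ tsupport F := by
  refine closure_minimal (fun q hq => ?_) (isClosed_tsupport F)
  by_contra h
  have h0 : fderiv ℝ F q = 0 := by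
    by_contra h1
    exact h (support_fderiv_subset ℝ h1)
  refine hq (Finset.sum_eq_zero fun l _ => Finset.sum_eq_zero fun s _ => ?_)
  fin_cases s <;> fin_cases α <;> simp [nabla, partialD, h0]

/-- `d_α` on test forms. -/
def dTest {n j k : ℕ} {Ω : Opens (H n)} (α : Fin 2) (h : j + 1 = k) (η : TestForm Ω j) :
    TestForm Ω k :=
  mkTestForm (d α fun q => (η q : Lam n))
    (contDiffOn_univ.1 (contDiffOn_d isOpen_univ α (contDiff_coe η).contDiffOn))
    (η.hasCompactSupport.of_isClosed_subset (isClosed_tsupport _)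
      ((tsupport_d α _).trans (tsupport_coe η)))
    (((tsupport_d α _).trans (tsupport_coe η)).trans η.tsupport_subset)
    (fun _ => h ▸ d_mem_deg α (Filter.Eventually.of_forall fun y => (η y).2))

theorem contDiff_smul_form {n k : ℕ} {U : Opens (H n)} {ψ : H n → Lam n}
    (hψ : IsSmoothForm U k ψ) (φ : 𝓓(U, ℂ)) : ContDiff ℝ ∞ fun q => φ q • ψ q := by
  rw [contDiff_iff_contDiffAt]
  intro q
  by_cases hq : q ∈ tsupport φ
  · exact φ.contDiff.contDiffAt.smul
      (hψ.1.contDiffAt (U.isOpen.mem_nhds (φ.tsupport_subset hq)))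
  · have : (fun q => φ q • ψ q) =ᶠ[𝓝 q] fun _ => 0 := by
      filter_upwards [notMem_tsupport_iff_eventuallyEq.1 hq] with y hy
      rw [hy]
      exact zero_smul ℂ (ψ y)
    exact contDiffAt_const.congr_of_eventuallyEq this

theorem tsupport_smul_form {n : ℕ} {U : Opens (H n)} (ψ : H n → Lam n) (φ : 𝓓(U, ℂ)) :
    tsupport (fun q => φ q • ψ q) ⊆ tsupport φ :=
  closure_mono fun q hq h0 => hq (by
    show φ q • ψ q = 0
    rw [show φ q = 0 from h0]
    exact zero_smul ℂ (ψ q))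

/-- The test form `φ ψ` on `Ω`, for a test function `φ` on an open set `U ⊆ Ω` and a smooth form
`ψ` on `U`. -/
def smulForm {n k : ℕ} {U Ω : Opens (H n)} (hU : U ≤ Ω) {ψ : H n → Lam n}
    (hψ : IsSmoothForm U k ψ) (φ : 𝓓(U, ℂ)) : TestForm Ω k :=
  mkTestForm (fun q => φ q • ψ q) (contDiff_smul_form hψ φ)
    (φ.hasCompactSupport.of_isClosed_subset (isClosed_tsupport _) (tsupport_smul_form ψ φ))
    ((tsupport_smul_form ψ φ).trans (φ.tsupport_subset.trans hU))
    (fun q => by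
      by_cases hq : q ∈ (U : Set (H n))
      · exact (deg n k).smul_mem _ (hψ.2 q hq)
      · have h0 : φ q = 0 := by
          by_contra h
          exact hq (φ.tsupport_subset (subset_tsupport _ h))
        rw [h0, zero_smul]
        exact (deg n k).zero_mem)

/-! ### Currents -/

/-- The continuous dual of the space of test `k`-forms on `Ω`, that is, the space of
`(2n-k)`-currents on `Ω`. -/
abbrev Current {n : ℕ} (Ω : Opens (H n)) (k : ℕ) : Type := TestForm Ω k →L[ℂ] ℂ

/-- `T` is closed: `d₀ T = d₁ T = 0`, where `(d_α T)(η) = -T(d_α η)` for test `(k-1)`-forms `η`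
(there are none for `k = 0`). -/
def IsClosedCurrent {n k : ℕ} {Ω : Opens (H n)} (T : Current Ω k) : Prop :=
  ∀ (α : Fin 2) (j : ℕ) (h : j + 1 = k) (η : TestForm Ω j), -T (dTest α h η) = 0

/-- A `(2n-2p)`-current is positive if it is nonnegative on all strongly positive test
`2p`-forms. -/
def IsPositiveCurrent {n p : ℕ} {Ω : Opens (H n)} (T : Current Ω (2 * p)) : Prop :=
  ∀ η : TestForm Ω (2 * p), (∀ q, (η q : Lam n) ∈ SP n p) → 0 ≤ (T η).re ∧ (T η).im = 0

/-- The `2n`-current (distribution) `T ∧ ψ` on the open set `U ⊆ Ω`,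
`(T ∧ ψ)(φ) = T(φ ψ)`, for a `(2n-k)`-current `T` on `Ω` and a smooth `k`-form `ψ` on `U`. -/
def wedge {n k : ℕ} {Ω : Opens (H n)} (T : Current Ω k) {U : Opens (H n)} (hU : U ≤ Ω)
    {ψ : H n → Lam n} (hψ : IsSmoothForm U k ψ) (φ : 𝓓(U, ℂ)) : ℂ :=
  T (smulForm hU hψ φ)

/-- The `2n`-current `S` on `U` is `μ Ω_{2n}` for the positive Radon measure `μ` on `U` (regarded
as a Borel measure on `ℍⁿ` without mass outside `U`). -/
def IsMeasureOf {n : ℕ} {U : Opens (H n)} (S : 𝓓(U, ℂ) → ℂ) (μ : Measure (H n)) : Prop :=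
  μ (U : Set (H n))ᶜ = 0 ∧ (∀ K : Set (H n), IsCompact K → K ⊆ U → μ K < ⊤) ∧
    ∀ φ : 𝓓(U, ℂ), S φ = ∫ q, φ q ∂μ

open Classical in
/-- The measure of a `2n`-current that is given by a positive Radon measure (which is unique). -/
def measureOf {n : ℕ} {U : Opens (H n)} (S : 𝓓(U, ℂ) → ℂ) : Measure (H n) :=
  if h : ∃ μ, IsMeasureOf S μ then h.choose else 0

/-- `∫_B S := μ(B)` for a `2n`-current `S = μ Ω_{2n}`. -/
def integralOn {n : ℕ} {U : Opens (H n)} (S : 𝓓(U, ℂ) → ℂ) (B : Set (H n)) : ℝ :=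
  (measureOf S).real B

/-! ### The Lelong number -/

/-- The `2n`-current `T ∧ β_n^p`. -/
def wedgeBeta {n p : ℕ} {Ω : Opens (H n)} (T : Current Ω (2 * p)) : 𝓓(Ω, ℂ) → ℂ :=
  wedge T le_rfl (isSmoothForm_beta_pow (Ω : Set (H n)) p)

/-- `σ_T(a, r) = ∫_{B(a,r)} T ∧ β_n^p`. -/
def sigma {n p : ℕ} {Ω : Opens (H n)} (T : Current Ω (2 * p)) (a : H n) (r : ℝ) : ℝ :=
  integralOn (wedgeBeta T) (ball a r)

/-- `ν` is the Lelong number of `T` at `a`: `ν = lim_{r → 0+} σ_T(a, r) / r^{4p}`. -/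
def IsLelongNumber {n p : ℕ} {Ω : Opens (H n)} (T : Current Ω (2 * p)) (a : H n) (ν : ℝ) : Prop :=
  Tendsto (fun r : ℝ => sigma T a r / r ^ (4 * p)) (𝓝[>] 0) (𝓝 ν)

/-- `Ω ∖ {a}`. -/
def puncture {n : ℕ} (Ω : Opens (H n)) (a : H n) : Opens (H n) :=
  ⟨(Ω : Set (H n)) \ {a}, Ω.isOpen.sdiff isClosed_singleton⟩

theorem puncture_le {n : ℕ} (Ω : Opens (H n)) (a : H n) : puncture Ω a ≤ Ω :=
  fun _ hq => hq.1

/-- The function `-‖q - a‖⁻²`. -/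
def kernel {n : ℕ} (a q : H n) : ℝ := -(1 / ‖q - a‖ ^ 2)

theorem contDiffOn_kernel {n : ℕ} (Ω : Opens (H n)) (a : H n) :
    ContDiffOn ℝ ∞ (kernel a) (puncture Ω a : Set (H n)) := by
  have h : ContDiff ℝ ∞ fun q : H n => ‖q - a‖ ^ 2 :=
    (contDiff_id.sub contDiff_const).norm_sq ℝ
  refine (ContDiffOn.div contDiffOn_const h.contDiffOn fun q hq => ?_).neg
  exact pow_ne_zero _ (norm_ne_zero_iff.2 (sub_ne_zero.2 fun e => hq.2 e))

/-- The `2n`-current `T ∧ (△(-‖q - a‖⁻²))^p` on `Ω ∖ {a}`. -/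
def wedgeKernel {n p : ℕ} {Ω : Opens (H n)} (T : Current Ω (2 * p)) (a : H n) :
    𝓓(puncture Ω a, ℂ) → ℂ :=
  wedge T (puncture_le Ω a)
    (isSmoothForm_baston_pow (puncture Ω a).isOpen (contDiffOn_kernel Ω a) p)

end QCurrent

end

/-!
Write `t = ‖q - a‖²`, and let `η₀`, `η₁` be the pull-backs of the basis `ω̃⁰`, `ω̃¹` along
`w ↦ ∑ v̄_l w_l`, where `v = q - a`, and `θ = η₀ ∧ η₁`. Differentiating twice gives
`△(-t⁻¹) = 8 t⁻³ (t β_n - θ)`. By a Lagrange identity `t β_n - θ` is strongly positive, as is `β_n`,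
so positivity of `T` and the Riesz representation theorem provide both measures.

As `θ ∧ θ = 0`, only `t^p β_n^p - p t^{p-1} θ ∧ β_n^{p-1}` survives in `(t β_n - θ)^p`. For a smooth
`F`, closedness of `T` applied to the differential of `F(t) η₁ ∧ β_n^{p-1}` trades
`F'(t) θ ∧ β_n^{p-1}` for a multiple of `F(t) β_n^p`. So `φ(t)` integrates against
`T ∧ (△(-t⁻¹))^p` as `8^p (2p F + t F')(t)` does against `T ∧ β_n^p`, where `F' = φ / t^{2p+1}`.
When `φ` tends to the indicator function of `(r₁², r₂²)`, the function `2p F + t F'` tends to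
`r₂^{-4p}` on `B(a, r₂)` minus `r₁^{-4p}` on the closed ball `B̄(a, r₁)`.
-/

noncomputable section

namespace QCurrent

open scoped CompactlySupported

/-! ### Positive functionals on test functions are measures -/

section PositiveFunctional

variable {E F : Type*} [NormedAddCommGroup E] [NormedSpace ℝ E] [NormedAddCommGroup F]
  [NormedSpace ℝ F] {U : Opens E}

theorem testFunction_eq_zero_of_notMem (φ : 𝓓(U, F)) {q : E} (hq : q ∉ U) : φ q = 0 :=
  image_eq_zero_of_notMem_tsupport fun h => hq (φ.tsupport_subset h)

theorem integrable_testFunction [MeasurableSpace E] [BorelSpace E] {μ : Measure E}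
    (hμ : ∀ K, IsCompact K → K ⊆ U → μ K < ⊤) (φ : 𝓓(U, F)) : Integrable φ μ := by
  obtain ⟨C, hC⟩ := φ.continuous.bounded_above_of_compact_support φ.hasCompactSupport
  rw [← integrableOn_iff_integrable_of_support_subset (subset_tsupport φ)]
  exact Measure.integrableOn_of_bounded (hμ _ φ.hasCompactSupport φ.tsupport_subset).ne
    (φ.continuous.stronglyMeasurable_of_hasCompactSupport φ.hasCompactSupport).aestronglyMeasurable
    (Eventually.of_forall hC)

/-- The restriction of a test function on `U` to the subtype `U`, on which the Riesz representation
theorem is available. -/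
def restrictTest (U : Opens E) : 𝓓(U, ℝ) →ₗ[ℝ] C_c(U, ℝ) where
  toFun φ :=
    { toFun := fun q => φ q
      continuous_toFun := φ.continuous.comp continuous_subtype_val
      hasCompactSupport' := by
        have hK : IsCompact ((↑) ⁻¹' tsupport φ : Set U) :=
          IsInducing.subtypeVal.isCompact_preimage' φ.hasCompactSupport
            (by simpa using φ.tsupport_subset)
        exact hK.of_isClosed_subset (isClosed_tsupport _) (closure_minimal
          (fun q hq => subset_tsupport φ hq)
          ((isClosed_tsupport φ).preimage continuous_subtype_val)) }
  map_add' _ _ := rfl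
  map_smul' _ _ := rfl

theorem restrictTest_injective : Function.Injective (restrictTest U) := by
  intro φ ψ h
  ext q
  by_cases hq : q ∈ U
  · exact DFunLike.congr_fun h (⟨q, hq⟩ : U)
  · rw [testFunction_eq_zero_of_notMem φ hq, testFunction_eq_zero_of_notMem ψ hq]

variable [FiniteDimensional ℝ E]

theorem exists_testFunction_eq_one {K : Set E} (hK : IsCompact K) (hKU : K ⊆ U) :
    ∃ χ : 𝓓(U, ℝ), (∀ q, 0 ≤ χ q) ∧ ∀ q ∈ K, χ q = 1 := by
  obtain ⟨L, hL, hKL, hLU⟩ := exists_compact_between hK U.isOpen hKU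
  obtain ⟨f, hf, hfL, hf01⟩ := exists_contMDiffMap_one_nhds_of_subset_interior
    (I := modelWithCornersSelf ℝ E) (n := ⊤) hK.isClosed hKL
  have hsub : tsupport f ⊆ L :=
    closure_minimal (fun q hq => not_not.1 fun h => hq (hfL q h)) hL.isClosed
  exact ⟨⟨f, f.contMDiff.contDiff, hL.of_isClosed_subset (isClosed_tsupport _) hsub,
    hsub.trans hLU⟩, fun q => (hf01 q).1,
    fun q hq => (hf.filter_mono (nhds_le_nhdsSet hq)).self_of_nhds⟩

theorem exists_testFunction_add_nonneg (g : C_c(U, ℝ)) :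
    ∃ χ : 𝓓(U, ℝ), (∀ q, 0 ≤ χ q) ∧ ∀ q : U, 0 ≤ χ q + g q := by
  obtain ⟨C, hC⟩ := g.continuous.bounded_above_of_compact_support g.hasCompactSupport
  obtain ⟨χ, hχ0, hχ1⟩ := exists_testFunction_eq_one (U := U)
    (g.hasCompactSupport.isCompact.image continuous_subtype_val)
    (image_subset_iff.2 fun q _ => q.2)
  refine ⟨|C| • χ, fun q => mul_nonneg (abs_nonneg C) (hχ0 q), fun q => ?_⟩
  change 0 ≤ |C| * χ q + g q
  by_cases hq : q ∈ tsupport g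
  · rw [hχ1 q ⟨q, hq, rfl⟩]
    have := (abs_le.1 (hC q)).1
    change -C ≤ g q at this
    linarith [le_abs_self C]
  · rw [image_eq_zero_of_notMem_tsupport hq, add_zero]
    exact mul_nonneg (abs_nonneg C) (hχ0 q)

theorem exists_positiveLinearMap_extension (Λ : 𝓓(U, ℝ) →ₗ[ℝ] ℝ)
    (hΛ : ∀ φ, (∀ q, 0 ≤ φ q) → 0 ≤ Λ φ) :
    ∃ Φ : C_c(U, ℝ) →ₚ[ℝ] ℝ, ∀ φ, Φ (restrictTest U φ) = Λ φ := by
  let e := LinearEquiv.ofInjective (restrictTest U) restrictTest_injective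
  let f : C_c(U, ℝ) →ₗ.[ℝ] ℝ := ⟨LinearMap.range (restrictTest U), Λ ∘ₗ e.symm.toLinearMap⟩
  let nonneg : PointedCone ℝ C_c(U, ℝ) :=
    { carrier := {g | ∀ q, 0 ≤ g q}
      zero_mem' := fun _ => le_rfl
      smul_mem' := fun c _ hg q => mul_nonneg c.2 (hg q)
      add_mem' := fun hg hg' q => add_nonneg (hg q) (hg' q) }
  have hf : ∀ φ, f (e φ) = Λ φ := fun φ => congrArg Λ (e.symm_apply_apply φ)
  have hnonneg : ∀ x : f.domain, (x : C_c(U, ℝ)) ∈ nonneg → 0 ≤ f x := by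
    intro x hx
    obtain ⟨φ, rfl⟩ := e.surjective x
    rw [hf]
    refine hΛ φ fun q => ?_
    by_cases hq : q ∈ U
    · exact hx ⟨q, hq⟩
    · rw [testFunction_eq_zero_of_notMem φ hq]
  have hdense : ∀ g, ∃ x : f.domain, (x : C_c(U, ℝ)) + g ∈ nonneg :=
    fun g => (exists_testFunction_add_nonneg g).imp' e fun _ h => h.2
  obtain ⟨Φ, hΦf, hΦ⟩ := riesz_extension _ f hnonneg hdense
  exact ⟨PositiveLinearMap.mk₀ Φ hΦ, fun φ => (hΦf (e φ)).trans (hf φ)⟩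

variable [MeasurableSpace E] [BorelSpace E]

theorem exists_measure_of_nonneg (Λ : 𝓓(U, ℝ) →ₗ[ℝ] ℝ) (hΛ : ∀ φ, (∀ q, 0 ≤ φ q) → 0 ≤ Λ φ) :
    ∃ μ : Measure E, μ (U : Set E)ᶜ = 0 ∧ (∀ K, IsCompact K → K ⊆ U → μ K < ⊤) ∧
      ∀ φ, Λ φ = ∫ q, φ q ∂μ := by
  obtain ⟨Φ, hΦ⟩ := exists_positiveLinearMap_extension Λ hΛ
  have : LocallyCompactSpace U := U.isOpen.locallyCompactSpace
  have hemb : MeasurableEmbedding ((↑) : U → E) :=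
    MeasurableEmbedding.subtype_coe U.isOpen.measurableSet
  refine ⟨(RealRMK.rieszMeasure Φ).map (↑), ?_, fun K hK hKU => ?_, fun φ => ?_⟩
  · rw [hemb.map_apply, preimage_compl, Subtype.coe_preimage_self, compl_univ, measure_empty]
  · obtain ⟨χ, hχ0, hχ1⟩ := exists_testFunction_eq_one hK hKU
    have hK' : IsCompact ((↑) ⁻¹' K : Set U) :=
      IsInducing.subtypeVal.isCompact_preimage' hK (by simpa using hKU)
    rw [hemb.map_apply]
    exact (RealRMK.rieszMeasure_le_of_eq_one Φ (f := restrictTest U χ) (fun q => hχ0 q) hK'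
      fun q hq => hχ1 q hq).trans_lt ENNReal.ofReal_lt_top
  · rw [hemb.integral_map, ← hΦ]
    exact (RealRMK.integral_rieszMeasure Φ (restrictTest U φ)).symm

end PositiveFunctional

section MeasureOf

variable {n : ℕ} {U : Opens (H n)}

/-- The inclusion of the real test functions in the complex ones. -/
def realTest (U : Opens (H n)) : 𝓓(U, ℝ) →L[ℝ] 𝓓(U, ℂ) :=
  TestFunction.postcompCLM Complex.ofRealCLM

theorem realTest_apply (φ : 𝓓(U, ℝ)) (q : H n) : realTest U φ q = (φ q : ℂ) := by
  simp [realTest]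

theorem im_realTest_eq_zero (S : 𝓓(U, ℂ) →ₗ[ℂ] ℂ)
    (hS : ∀ φ : 𝓓(U, ℝ), (∀ q, 0 ≤ φ q) → (S (realTest U φ)).im = 0) (φ : 𝓓(U, ℝ)) :
    (S (realTest U φ)).im = 0 := by
  obtain ⟨χ, hχ, hφχ⟩ := exists_testFunction_add_nonneg (restrictTest U φ)
  have hsum : (S (realTest U (χ + φ))).im = 0 := by
    refine hS _ fun q => ?_
    by_cases hq : q ∈ U
    · exact hφχ ⟨q, hq⟩
    · rw [testFunction_eq_zero_of_notMem (χ + φ) hq]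
  rwa [map_add, map_add, Complex.add_im, hS χ hχ, zero_add] at hsum

theorem exists_isMeasureOf (S : 𝓓(U, ℂ) →ₗ[ℂ] ℂ)
    (hS : ∀ φ : 𝓓(U, ℝ), (∀ q, 0 ≤ φ q) → 0 ≤ (S (realTest U φ)).re ∧ (S (realTest U φ)).im = 0) :
    ∃ μ, IsMeasureOf S μ := by
  obtain ⟨μ, hμU, hμK, hμ⟩ := exists_measure_of_nonneg
    (Complex.reLm ∘ₗ S.restrictScalars ℝ ∘ₗ (realTest U).toLinearMap) fun φ hφ => (hS φ hφ).1
  have hreal : ∀ φ : 𝓓(U, ℝ), S (realTest U φ) = ((∫ q, φ q ∂μ : ℝ) : ℂ) := fun φ =>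
    Complex.ext (hμ φ) (im_realTest_eq_zero S (fun φ hφ => (hS φ hφ).2) φ)
  refine ⟨μ, hμU, hμK, fun φ => ?_⟩
  let φr : 𝓓(U, ℝ) := TestFunction.postcompCLM Complex.reCLM φ
  let φi : 𝓓(U, ℝ) := TestFunction.postcompCLM Complex.imCLM φ
  have hφr : ∀ q, φr q = (φ q).re := fun q => by simp [φr]
  have hφi : ∀ q, φi q = (φ q).im := fun q => by simp [φi]
  have hφ : φ = realTest U φr + Complex.I • realTest U φi := by
    ext q
    change φ q = realTest U φr q + Complex.I * realTest U φi q
    rw [realTest_apply, realTest_apply, hφr, hφi, mul_comm, Complex.re_add_im]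
  calc S φ = ((∫ q, (φ q).re ∂μ : ℝ) : ℂ) + ((∫ q, (φ q).im ∂μ : ℝ) : ℂ) * Complex.I := by
        rw [hφ, map_add, map_smul, hreal, hreal, ← hφ, smul_eq_mul, mul_comm]
        simp only [hφr, hφi]
    _ = ∫ q, φ q ∂μ := integral_re_add_im (integrable_testFunction hμK φ)

end MeasureOf

/-! ### Strongly positive elements -/

section StronglyPositive

variable {n : ℕ}

theorem mul_self_of_mem_deg_one {x : Lam n} (hx : x ∈ deg n 1) : x * x = 0 := by
  change x ∈ (LinearMap.range (ExteriorAlgebra.ι ℂ : (Idx n → ℂ) →ₗ[ℂ] _)) ^ 1 at hx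
  rw [pow_one] at hx
  obtain ⟨w, rfl⟩ := hx
  exact ExteriorAlgebra.ι_sq_zero w

theorem mul_anticomm_of_mem_deg_one {x y : Lam n} (hx : x ∈ deg n 1) (hy : y ∈ deg n 1) :
    x * y = -(y * x) := by
  have h := mul_self_of_mem_deg_one ((deg n 1).add_mem hx hy)
  rw [mul_add, add_mul, add_mul, mul_self_of_mem_deg_one hx, mul_self_of_mem_deg_one hy,
    zero_add, add_zero] at h
  exact eq_neg_of_add_eq_zero_right h

theorem commute_mul_of_mem_deg_one {x y z : Lam n} (hx : x ∈ deg n 1) (hy : y ∈ deg n 1)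
    (hz : z ∈ deg n 1) : Commute (x * y) z := by
  change x * y * z = z * (x * y)
  rw [mul_assoc, mul_anticomm_of_mem_deg_one hy hz, mul_neg, ← mul_assoc,
    mul_anticomm_of_mem_deg_one hx hz, neg_mul, neg_neg, mul_assoc]

theorem pullback_mem (η : Fin n → ℍ[ℝ]) (s : Fin 2) : pullback η s ∈ deg n 1 :=
  Submodule.sum_mem _ fun _ _ => Submodule.sum_mem _ fun _ _ => (deg n 1).smul_mem _ (om_mem _)

theorem tau_add (a b : ℍ[ℝ]) : tau (a + b) = tau a + tau b := by
  ext s t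
  fin_cases s <;> fin_cases t <;> simp [tau] <;> ring

theorem tau_mul (a b : ℍ[ℝ]) : tau (a * b) = tau a * tau b := by
  ext s t
  fin_cases s <;> fin_cases t <;>
    simp [tau, Matrix.mul_apply, Fin.sum_univ_two, Complex.ext_iff] <;> constructor <;> ring

theorem tau_real_smul (c : ℝ) (a : ℍ[ℝ]) : tau (c • a) = c • tau a := by
  ext s t
  fin_cases s <;> fin_cases t <;> simp [tau] <;> ring

/-- The pull-back `η ↦ η^* ω̃^s` as a real linear map. -/
def pullbackₗ (s : Fin 2) : (Fin n → ℍ[ℝ]) →ₗ[ℝ] Lam n where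
  toFun η := pullback η s
  map_add' η ζ := by
    simp only [pullback, Pi.add_apply, tau_add, Matrix.add_apply, add_smul,
      Finset.sum_add_distrib]
  map_smul' c η := by
    simp only [pullback, Pi.smul_apply, tau_real_smul, Matrix.smul_apply, smul_assoc,
      Finset.smul_sum, RingHom.id_apply]

theorem pullbackₗ_apply (s : Fin 2) (η : Fin n → ℍ[ℝ]) : pullbackₗ s η = pullback η s := rfl

theorem pullback_quaternion_smul (c : ℍ[ℝ]) (η : Fin n → ℍ[ℝ]) (s : Fin 2) :
    pullback (c • η) s = ∑ t, tau c s t • pullback η t := by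
  simp only [pullback, Pi.smul_apply, smul_eq_mul, tau_mul, Matrix.mul_apply, Fin.sum_univ_two,
    Finset.smul_sum, smul_add, add_smul, smul_smul, ← Finset.sum_add_distrib]
  exact Finset.sum_congr rfl fun l _ => by abel

theorem pullback_single (l : Fin n) (a : ℍ[ℝ]) (s : Fin 2) :
    pullback (Pi.single l a) s = ∑ t, tau a s t • om (toLex (l, t)) := by
  rw [pullback, Finset.sum_eq_single l]
  · rw [Pi.single_eq_same]
  · intro m _ hm
    rw [Pi.single_eq_of_ne hm]
    exact Finset.sum_eq_zero fun t _ => by fin_cases s <;> fin_cases t <;> simp [tau]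
  · exact fun h => absurd (Finset.mem_univ l) h

/-- The elementary `2`-element `θ(η) = η^*ω̃⁰ ∧ η^*ω̃¹`, as a quadratic map of `η`. -/
def theta : QuadraticMap ℝ (Fin n → ℍ[ℝ]) (Lam n) :=
  LinearMap.BilinMap.toQuadraticMap
    ((LinearMap.mul ℝ (Lam n)).compl₁₂ (pullbackₗ 0) (pullbackₗ 1))

theorem theta_apply (η : Fin n → ℍ[ℝ]) : theta η = pullback η 0 * pullback η 1 := rfl

theorem commute_theta {x : Lam n} (hx : x ∈ deg n 1) (η : Fin n → ℍ[ℝ]) : Commute (theta η) x :=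
  commute_mul_of_mem_deg_one (pullback_mem η 0) (pullback_mem η 1) hx

theorem theta_mul_pullback_self (η : Fin n → ℍ[ℝ]) (s : Fin 2) : theta η * pullback η s = 0 := by
  have hsq : ∀ s, pullback η s * pullback η s = 0 := fun s =>
    mul_self_of_mem_deg_one (pullback_mem η s)
  fin_cases s
  · change theta η * pullback η 0 = 0
    rw [(commute_theta (pullback_mem η 0) η).eq, theta_apply, ← mul_assoc, hsq, zero_mul]
  · change theta η * pullback η 1 = 0
    rw [theta_apply, mul_assoc, hsq, mul_zero]

theorem theta_mul_self (η : Fin n → ℍ[ℝ]) : theta η * theta η = 0 := by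
  rw [theta_apply η, ← mul_assoc, ← theta_apply, theta_mul_pullback_self, zero_mul]

theorem commute_theta_beta (η : Fin n → ℍ[ℝ]) : Commute (theta η) (beta n) :=
  Commute.sum_right _ _ _ fun _ _ =>
    (commute_theta (om_mem _) η).mul_right (commute_theta (om_mem _) η)

theorem theta_single (l : Fin n) (a : ℍ[ℝ]) : theta (Pi.single l a) =
    Quaternion.normSq a • (om (toLex (l, 0)) * om (toLex (l, 1)) : Lam n) := by
  have hsq : ∀ t : Fin 2, om (toLex (l, t)) * om (toLex (l, t)) = 0 := fun t =>
    mul_self_of_mem_deg_one (om_mem _)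
  have hswap : om (toLex (l, 1)) * om (toLex (l, 0)) = -(om (toLex (l, 0)) * om (toLex (l, 1))) :=
    mul_anticomm_of_mem_deg_one (om_mem _) (om_mem _)
  have hdet : tau a 0 0 * tau a 1 1 - tau a 0 1 * tau a 1 0 = (Quaternion.normSq a : ℝ) := by
    simp [tau, Quaternion.normSq_def', Complex.ext_iff, sq]
    constructor <;> ring
  rw [← Complex.coe_smul, ← hdet, theta_apply, pullback_single, pullback_single]
  simp only [Fin.sum_univ_two, mul_add, add_mul, smul_mul_smul_comm, hsq, hswap, smul_zero,
    smul_neg, zero_add, add_zero, sub_smul, neg_add_eq_sub]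

theorem beta_eq_sum_theta : beta n = ∑ l, theta (Pi.single l 1) := by
  simp only [beta, theta_single, map_one, one_smul]

theorem theta_single_eq_smul (l : Fin n) (a : ℍ[ℝ]) :
    theta (Pi.single l a) = Quaternion.normSq a • theta (Pi.single l 1) := by
  simp only [theta_single, map_one, one_smul]

/-- The product `θ(η_1) ∧ … ∧ θ(η_k)`, without any condition of linear independence. -/
def thetaProd {k : ℕ} (η : Fin k → Fin n → ℍ[ℝ]) : Lam n :=
  (List.ofFn fun i : Fin k => theta (η i)).prod

theorem thetaProd_snoc {k : ℕ} (η : Fin k → Fin n → ℍ[ℝ]) (ζ : Fin n → ℍ[ℝ]) :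
    thetaProd (Fin.snoc η ζ : Fin (k + 1) → Fin n → ℍ[ℝ]) = thetaProd η * theta ζ := by
  rw [thetaProd, List.ofFn_succ', List.concat_eq_append, List.prod_append, List.prod_singleton]
  simp only [Fin.snoc_castSucc, Fin.snoc_last, thetaProd]

theorem thetaProd_mul_pullback {k : ℕ} (η : Fin k → Fin n → ℍ[ℝ]) (i : Fin k) (s : Fin 2) :
    thetaProd η * pullback (η i) s = 0 := by
  induction η using Fin.snocInduction with
  | elim0 => exact i.elim0
  | snoc η ζ ih =>
    rw [thetaProd_snoc, mul_assoc]
    refine Fin.lastCases ?_ (fun j => ?_) i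
    · rw [Fin.snoc_last, theta_mul_pullback_self, mul_zero]
    · rw [Fin.snoc_castSucc, (commute_theta (pullback_mem _ s) _).eq, ← mul_assoc, ih j, zero_mul]

theorem thetaProd_mul_pullback_of_mem_span {k : ℕ} {η : Fin k → Fin n → ℍ[ℝ]}
    {ζ : Fin n → ℍ[ℝ]} (hζ : ζ ∈ Submodule.span ℍ[ℝ] (Set.range η)) (s : Fin 2) :
    thetaProd η * pullback ζ s = 0 := by
  induction hζ using Submodule.span_induction generalizing s with
  | mem ζ hζ =>
    obtain ⟨i, rfl⟩ := hζ
    exact thetaProd_mul_pullback η i s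
  | zero => rw [← pullbackₗ_apply, map_zero, mul_zero]
  | add ζ ζ' _ _ ih ih' =>
    rw [← pullbackₗ_apply, map_add, mul_add, pullbackₗ_apply, pullbackₗ_apply, ih, ih', add_zero]
  | smul c ζ _ ih =>
    rw [pullback_quaternion_smul, Finset.mul_sum]
    exact Finset.sum_eq_zero fun t _ => by rw [mul_smul_comm, ih, smul_zero]

theorem thetaProd_eq_zero {k : ℕ} {η : Fin k → Fin n → ℍ[ℝ]}
    (hη : ¬LinearIndependent ℍ[ℝ] η) : thetaProd η = 0 := by
  induction η using Fin.snocInduction with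
  | elim0 => exact absurd linearIndependent_empty_type hη
  | snoc η ζ ih =>
    rw [thetaProd_snoc]
    by_cases hη' : LinearIndependent ℍ[ℝ] η
    · have hζ : ζ ∈ Submodule.span ℍ[ℝ] (Set.range η) :=
        not_not.1 fun hζ => hη (linearIndependent_finSnoc.2 ⟨hη', hζ⟩)
      rw [theta_apply, ← mul_assoc, thetaProd_mul_pullback_of_mem_span hζ, zero_mul]
    · rw [ih hη', zero_mul]

/-- The convex cone `SP^{2k} ℂ²ⁿ` as a `PointedCone`. -/
def spCone (n k : ℕ) : PointedCone ℝ (Lam n) where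
  carrier := SP n k
  zero_mem' := ⟨0, Fin.elim0, Fin.elim0, fun i => i.elim0, fun i => i.elim0, by simp⟩
  add_mem' := by
    rintro _ _ ⟨m, c, ξ, hc, hξ, rfl⟩ ⟨m', c', ξ', hc', hξ', rfl⟩
    refine ⟨m + m', Fin.append c c', Fin.append ξ ξ', fun i => ?_, fun i => ?_, ?_⟩
    · refine Fin.addCases (fun i => ?_) (fun i => ?_) i
      · rw [Fin.append_left]; exact hc i
      · rw [Fin.append_right]; exact hc' i
    · refine Fin.addCases (fun i => ?_) (fun i => ?_) i
      · rw [Fin.append_left]; exact hξ i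
      · rw [Fin.append_right]; exact hξ' i
    · simp [Fin.sum_univ_add]
  smul_mem' := by
    rintro r _ ⟨m, c, ξ, hc, hξ, rfl⟩
    refine ⟨m, fun i => r * c i, ξ, fun i => mul_nonneg r.2 (hc i), hξ, ?_⟩
    rw [← Nonneg.coe_smul, ← Complex.coe_smul]
    simp only [Finset.smul_sum, smul_smul, Complex.ofReal_mul]

theorem thetaProd_mem_spCone {k : ℕ} (η : Fin k → Fin n → ℍ[ℝ]) : thetaProd η ∈ spCone n k := by
  by_cases h : LinearIndependent ℍ[ℝ] η
  · exact ⟨1, fun _ => 1, fun _ => thetaProd η, fun _ => zero_le_one, fun _ => ⟨η, h, rfl⟩, by simp⟩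
  · rw [thetaProd_eq_zero h]
    exact zero_mem _

theorem theta_mem_spCone (η : Fin n → ℍ[ℝ]) : theta η ∈ spCone n 1 := by
  have h := thetaProd_mem_spCone fun _ : Fin 1 => η
  rwa [thetaProd, List.ofFn_succ, List.ofFn_zero, List.prod_singleton] at h

theorem mul_mem_spCone {k : ℕ} {x y : Lam n} (hx : x ∈ spCone n k) (hy : y ∈ spCone n 1) :
    x * y ∈ spCone n (k + 1) := by
  obtain ⟨m, c, ξ, hc, hξ, rfl⟩ := hx
  obtain ⟨m', c', ξ', hc', hξ', rfl⟩ := hy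
  rw [Finset.sum_mul_sum]
  refine sum_mem fun i _ => sum_mem fun j _ => ?_
  obtain ⟨η, -, hη⟩ := hξ i
  obtain ⟨ζ, -, hζ⟩ := hξ' j
  rw [List.ofFn_succ, List.ofFn_zero, List.prod_singleton, ← theta_apply] at hζ
  have hmul : ξ i * ξ' j = thetaProd (Fin.snoc η (ζ 0) : Fin (k + 1) → Fin n → ℍ[ℝ]) := by
    rw [thetaProd_snoc, hη, hζ]
    rfl
  rw [smul_mul_smul_comm, ← Complex.ofReal_mul, Complex.coe_smul, hmul]
  exact (spCone n _).smul_mem (mul_nonneg (hc i) (hc' j)) (thetaProd_mem_spCone _)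

theorem pow_mem_spCone {x : Lam n} (hx : x ∈ spCone n 1) (p : ℕ) : x ^ p ∈ spCone n p := by
  induction p with
  | zero =>
    have h := thetaProd_mem_spCone (n := n) (Fin.elim0 : Fin 0 → Fin n → ℍ[ℝ])
    rwa [thetaProd, List.ofFn_zero, List.prod_nil, ← pow_zero x] at h
  | succ p ih => exact pow_succ x p ▸ mul_mem_spCone ih hx

theorem beta_mem_spCone : beta n ∈ spCone n 1 := by
  rw [beta_eq_sum_theta]
  exact sum_mem fun l _ => theta_mem_spCone _

/-- For `a, b ≠ 0` the difference is a positive multiple of `θ(|b|² a e_l - |a|² b e_m)`. -/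
theorem smul_add_smul_sub_polar_theta_single_mem_spCone (l m : Fin n) (a b : ℍ[ℝ]) :
    Quaternion.normSq b • theta (Pi.single l 1) + Quaternion.normSq a • theta (Pi.single m 1) -
      QuadraticMap.polar theta (Pi.single l a) (Pi.single m b) ∈ spCone n 1 := by
  set s := Quaternion.normSq a with hs
  set t := Quaternion.normSq b with ht
  have hs0 : 0 ≤ s := Quaternion.normSq_nonneg
  have ht0 : 0 ≤ t := Quaternion.normSq_nonneg
  by_cases hst : t * s = 0
  · have hpolar : QuadraticMap.polar theta (Pi.single l a) (Pi.single m b : Fin n → ℍ[ℝ]) = 0 := by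
      rcases mul_eq_zero.1 hst with h | h
      · rw [Quaternion.normSq_eq_zero.1 h, Pi.single_zero, QuadraticMap.polar_zero_right]
      · rw [Quaternion.normSq_eq_zero.1 h, Pi.single_zero, QuadraticMap.polar_zero_left]
    rw [hpolar, sub_zero]
    exact add_mem ((spCone n 1).smul_mem ht0 (theta_mem_spCone _))
      ((spCone n 1).smul_mem hs0 (theta_mem_spCone _))
  · have hθ : theta (t • (Pi.single l a : Fin n → ℍ[ℝ]) + -s • (Pi.single m b : Fin n → ℍ[ℝ])) =
        (t * s) • (t • theta (Pi.single l 1) + s • theta (Pi.single m 1) -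
          QuadraticMap.polar theta (Pi.single l a) (Pi.single m b)) := by
      rw [QuadraticMap.map_add theta, QuadraticMap.map_smul, QuadraticMap.map_smul,
        QuadraticMap.polar_smul_left, QuadraticMap.polar_smul_right, theta_single_eq_smul l a,
        theta_single_eq_smul m b, ← hs, ← ht]
      module
    rw [← inv_smul_smul₀ hst (_ - _), ← hθ]
    exact (spCone n 1).smul_mem (inv_nonneg.2 (mul_nonneg ht0 hs0)) (theta_mem_spCone _)

theorem two_smul_theta (v : Fin n → ℍ[ℝ]) : 2 • theta v =
    ∑ l, ∑ m, QuadraticMap.polar theta (Pi.single l (v l)) (Pi.single m (v m)) := by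
  rw [← QuadraticMap.polar_self, ← QuadraticMap.polarBilin_apply_apply]
  conv_lhs => rw [← Finset.univ_sum_single v]
  simp only [map_sum, LinearMap.sum_apply, QuadraticMap.polarBilin_apply_apply]
  exact Finset.sum_comm

/-- Lagrange's identity writes the difference as a sum over pairs of coordinates. -/
theorem sum_normSq_smul_beta_sub_theta_mem_spCone (v : Fin n → ℍ[ℝ]) :
    (∑ l, Quaternion.normSq (v l)) • beta n - theta v ∈ spCone n 1 := by
  have hlagrange : (∑ l, Quaternion.normSq (v l)) • beta n - theta v = (1 / 2 : ℝ) • ∑ l, ∑ m,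
      (Quaternion.normSq (v m) • theta (Pi.single l 1) +
        Quaternion.normSq (v l) • theta (Pi.single m 1) -
        QuadraticMap.polar theta (Pi.single l (v l)) (Pi.single m (v m))) := by
    simp only [Finset.sum_sub_distrib, Finset.sum_add_distrib, ← two_smul_theta,
      ← Finset.smul_sum, ← Finset.sum_smul, ← beta_eq_sum_theta]
    module
  rw [hlagrange]
  exact (spCone n 1).smul_mem (by norm_num) (sum_mem fun l _ => sum_mem fun m _ =>
    smul_add_smul_sub_polar_theta_single_mem_spCone l m _ _)

end StronglyPositive

/-! ### The operators `d₀`, `d₁` and `△` on radial functions -/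

section Radial

variable {n : ℕ}

/-- The row `(v̄_l)` of the right `ℍ`-linear map `q ↦ ∑_l v̄_l q_l`. -/
def conjRow : H n →ₗ[ℝ] Fin n → ℍ[ℝ] where
  toFun v l := ⟨v (l, 0), -v (l, 1), -v (l, 2), -v (l, 3)⟩
  map_add' v w := by
    funext l
    refine Quaternion.ext _ _ rfl ?_ ?_ ?_ <;> exact neg_add _ _
  map_smul' c v := by
    funext l
    refine Quaternion.ext _ _ rfl ?_ ?_ ?_ <;> exact (mul_neg _ _).symm

@[simp]
theorem conjRow_re (v : H n) (l : Fin n) : (conjRow v l).re = v (l, 0) := rfl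

@[simp]
theorem conjRow_imI (v : H n) (l : Fin n) : (conjRow v l).imI = -v (l, 1) := rfl

@[simp]
theorem conjRow_imJ (v : H n) (l : Fin n) : (conjRow v l).imJ = -v (l, 2) := rfl

@[simp]
theorem conjRow_imK (v : H n) (l : Fin n) : (conjRow v l).imK = -v (l, 3) := rfl

theorem sum_normSq_conjRow (v : H n) : ∑ l, Quaternion.normSq (conjRow v l) = ‖v‖ ^ 2 := by
  rw [EuclideanSpace.norm_sq_eq, Fintype.sum_prod_type]
  refine Finset.sum_congr rfl fun l _ => ?_
  simp [Quaternion.normSq_def', Fin.sum_univ_four]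

/-- The conjugates `1, -𝐢, -𝐣, -𝐤` of the quaternionic units. -/
def conjUnit : Fin 4 → ℍ[ℝ] :=
  ![⟨1, 0, 0, 0⟩, ⟨0, -1, 0, 0⟩, ⟨0, 0, -1, 0⟩, ⟨0, 0, 0, -1⟩]

theorem normSq_conjUnit (i : Fin 4) : Quaternion.normSq (conjUnit i) = 1 := by
  rw [Quaternion.normSq_def']
  fin_cases i <;> simp [conjUnit]

theorem conjRow_single (l : Fin n) (i : Fin 4) :
    conjRow (EuclideanSpace.single (l, i) (1 : ℝ)) = Pi.single l (conjUnit i) := by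
  funext m
  rcases eq_or_ne m l with rfl | hm
  · rw [Pi.single_eq_same]
    fin_cases i <;> ext <;> simp [conjUnit]
  · rw [Pi.single_eq_of_ne hm]
    ext <;> simp [hm]

/-- The pull-back of `ω̃^s` by `q ↦ ∑_l v̄_l q_l`; as `d_eq_sum` shows, `v ↦ conjPullback s v` is
the principal symbol of `d_s`. -/
def conjPullback (s : Fin 2) : H n →ₗ[ℝ] Lam n :=
  pullbackₗ s ∘ₗ conjRow

theorem conjPullback_mem (s : Fin 2) (v : H n) : conjPullback s v ∈ deg n 1 := pullback_mem _ _

theorem conjPullback_zero_mul_one (v : H n) :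
    conjPullback 0 v * conjPullback 1 v = theta (conjRow v) := rfl

theorem conjPullback_eq_sum (s : Fin 2) (v : H n) :
    conjPullback s v = ∑ j, v j • conjPullback s (EuclideanSpace.single j 1) := by
  conv_lhs => rw [← (EuclideanSpace.basisFun (Fin n × Fin 4) ℝ).sum_repr v]
  simp only [map_sum, map_smul, EuclideanSpace.basisFun_repr, EuclideanSpace.basisFun_apply]

theorem d_eq_sum (α : Fin 2) (F : H n → Lam n) (q : H n) :
    d α F q = ∑ j, conjPullback α (EuclideanSpace.single j 1) *
      fderiv ℝ F q (EuclideanSpace.single j 1) := by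
  rw [Fintype.sum_prod_type]
  refine Finset.sum_congr rfl fun l _ => ?_
  simp only [conjPullback, LinearMap.comp_apply, pullbackₗ_apply, conjRow_single, pullback_single]
  fin_cases α <;>
  · simp [Fin.sum_univ_two, Fin.sum_univ_four, nabla, partialD, tau, conjUnit, mul_add, mul_sub,
      add_mul]
    abel

theorem d_const (α : Fin 2) (w : Lam n) (q : H n) : d α (fun _ => w) q = 0 := by
  simp [d_eq_sum]

theorem d_smul {α : Fin 2} {f : H n → ℝ} {v q : H n} {G : H n → Lam n}
    (hf : HasGradientAt f v q) (hG : DifferentiableAt ℝ G q) :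
    d α (fun y => f y • G y) q = conjPullback α v * G q + f q • d α G q := by
  have hfG := (hf.hasFDerivAt.smul hG.hasFDerivAt).fderiv
  rw [d_eq_sum, d_eq_sum, conjPullback_eq_sum α v, Finset.sum_mul, Finset.smul_sum,
    ← Finset.sum_add_distrib]
  refine Finset.sum_congr rfl fun j _ => ?_
  change _ * fderiv ℝ (f • G) q _ = _
  rw [hfG]
  simp [EuclideanSpace.inner_single_right, mul_add, add_comm]

theorem hasGradientAt_comp_norm_sub_sq {g : ℝ → ℝ} {g' : ℝ} {a q : H n}
    (hg : HasDerivAt g g' (‖q - a‖ ^ 2)) :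
    HasGradientAt (fun y => g (‖y - a‖ ^ 2)) ((2 * g') • (q - a)) q := by
  have hnorm : HasFDerivAt (fun y : H n => ‖y - a‖ ^ 2) (2 • innerSL ℝ (q - a)) q := by
    simpa using ((hasFDerivAt_id q).sub_const a).norm_sq
  rw [hasGradientAt_iff_hasFDerivAt]
  refine (hg.comp_hasFDerivAt q hnorm).congr_fderiv ?_
  ext v
  simp
  ring

theorem d_radial_smul {α : Fin 2} {g : ℝ → ℝ} {g' : ℝ} {a q : H n} {G : H n → Lam n}
    (hg : HasDerivAt g g' (‖q - a‖ ^ 2)) (hG : DifferentiableAt ℝ G q) :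
    d α (fun y => g (‖y - a‖ ^ 2) • G y) q =
      (2 * g') • (conjPullback α (q - a) * G q) + g (‖q - a‖ ^ 2) • d α G q := by
  rw [d_smul (hasGradientAt_comp_norm_sub_sq hg) hG, map_smul, smul_mul_assoc]

theorem hasFDerivAt_conjPullback_mul (s : Fin 2) (a q : H n) (w : Lam n) :
    HasFDerivAt (fun y => conjPullback s (y - a) * w)
      (LinearMap.toContinuousLinearMap
        ((LinearMap.mulRight ℂ w).restrictScalars ℝ ∘ₗ conjPullback s)) q := by
  have h := (LinearMap.toContinuousLinearMap
    ((LinearMap.mulRight ℂ w).restrictScalars ℝ ∘ₗ conjPullback s)).hasFDerivAt (x := q - a)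
  exact h.comp q ((hasFDerivAt_id q).sub_const a)

theorem d_conjPullback_mul (a q : H n) (w : Lam n) :
    d 0 (fun y => conjPullback 1 (y - a) * w) q = (4 : ℝ) • (beta n * w) := by
  have hθ : ∀ j, conjPullback 0 (EuclideanSpace.single j (1 : ℝ) : H n) *
      conjPullback 1 (EuclideanSpace.single j 1) = theta (Pi.single j.1 1) := fun j => by
    rw [conjPullback_zero_mul_one, conjRow_single, theta_single_eq_smul, normSq_conjUnit, one_smul]
  calc d 0 (fun y => conjPullback 1 (y - a) * w) q
      = ∑ j, conjPullback 0 (EuclideanSpace.single j 1) *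
          (conjPullback 1 (EuclideanSpace.single j 1) * w) := by
        rw [d_eq_sum, (hasFDerivAt_conjPullback_mul 1 a q w).fderiv]
        rfl
    _ = (∑ j : Fin n × Fin 4, theta (Pi.single j.1 1)) * w := by
        simp only [← mul_assoc, hθ, Finset.sum_mul]
    _ = (4 : ℝ) • (beta n * w) := by
        rw [Fintype.sum_prod_type, beta_eq_sum_theta, ← smul_mul_assoc, Finset.smul_sum]
        simp only [Finset.sum_const, Finset.card_univ, Fintype.card_fin]
        norm_cast

theorem baston_kernel {a q : H n} (hq : q ≠ a) : baston (kernel a) q =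
    (8 / ‖q - a‖ ^ 6) • (‖q - a‖ ^ 2 • beta n - theta (conjRow (q - a))) := by
  have hu : ∀ {y : H n}, y ≠ a → ‖y - a‖ ≠ 0 := fun hy => norm_ne_zero_iff.2 (sub_ne_zero.2 hy)
  have hd₁ : d 1 (fun y => algebraMap ℂ (Lam n) (kernel a y : ℂ)) =ᶠ[𝓝 q]
      fun y => (2 / (‖y - a‖ ^ 2) ^ 2) • (conjPullback 1 (y - a) * 1) := by
    filter_upwards [isOpen_ne.mem_nhds hq] with y hy
    have hg : HasDerivAt (fun t : ℝ => -(1 / t)) (1 / (‖y - a‖ ^ 2) ^ 2) (‖y - a‖ ^ 2) := by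
      simpa only [one_div, neg_neg] using (hasDerivAt_inv (pow_ne_zero 2 (hu hy))).fun_neg
    have h := d_radial_smul (α := 1) hg (differentiableAt_const (1 : Lam n))
    rw [d_const, smul_zero, add_zero, mul_one_div] at h
    rw [← h]
    simp only [Algebra.algebraMap_eq_smul_one, kernel, Complex.coe_smul]
  have hg : HasDerivAt (fun t : ℝ => 2 / t ^ 2) (-4 / (‖q - a‖ ^ 2) ^ 3) (‖q - a‖ ^ 2) := by
    have hu := hu hq
    refine ((hasDerivAt_const _ (2 : ℝ)).div (hasDerivAt_pow 2 _) (by positivity)).congr_deriv ?_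
    norm_num
    field_simp
    norm_num
  have hd₀ := d_radial_smul (α := 0) hg (hasFDerivAt_conjPullback_mul 1 a q 1).differentiableAt
  have hcongr : ∀ {F G : H n → Lam n}, F =ᶠ[𝓝 q] G → d 0 F q = d 0 G q := fun h => by
    rw [d_eq_sum, d_eq_sum, h.fderiv_eq]
  rw [baston, hcongr hd₁, hd₀, d_conjPullback_mul, mul_one, mul_one, conjPullback_zero_mul_one,
    smul_sub, smul_smul, smul_smul]
  have hu := hu hq
  match_scalars
  · field_simp
    norm_num
  · field_simp
    norm_num

theorem sub_pow_of_mul_self_eq_zero {R : Type*} [Ring R] {x y : R} (hxy : Commute y x)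
    (hy : y * y = 0) (p : ℕ) : (x - y) ^ p = x ^ p - p • (y * x ^ (p - 1)) := by
  induction p with
  | zero => simp
  | succ p ih =>
    have hyy : y * x ^ (p - 1) * y = 0 := by
      rw [mul_assoc, ← (hxy.pow_right _).eq, ← mul_assoc, hy, zero_mul]
    have hyx : p • (y * x ^ (p - 1) * x) = p • (y * x ^ p) := by
      rcases p with _ | p
      · simp only [zero_smul]
      · rw [mul_assoc, Nat.add_sub_cancel, ← pow_succ]
    rw [pow_succ, ih, sub_mul, mul_sub, smul_mul_assoc, mul_sub, hyy, sub_zero, hyx, ← pow_succ,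
      ← (hxy.pow_right p).eq, Nat.add_sub_cancel, succ_nsmul]
    abel

/-- At `q = a` both sides vanish, so that no case distinction is needed later. -/
theorem pow_smul_baston_kernel_pow (a q : H n) (p : ℕ) :
    (‖q - a‖ ^ 2) ^ (2 * p + 1) • baston (kernel a) q ^ p = (8 : ℝ) ^ p •
      (‖q - a‖ ^ 2 • beta n ^ p - p • (theta (conjRow (q - a)) * beta n ^ (p - 1))) := by
  rcases eq_or_ne q a with rfl | hq
  · simp
  have hu : ‖q - a‖ ≠ 0 := norm_ne_zero_iff.2 (sub_ne_zero.2 hq)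
  have hcomm : Commute (theta (conjRow (q - a))) (‖q - a‖ ^ 2 • beta n) :=
    (commute_theta_beta _).smul_right _
  rw [baston_kernel hq, smul_pow, sub_pow_of_mul_self_eq_zero hcomm (theta_mul_self _)]
  rcases p with _ | p
  · simp
  · simp only [Nat.add_sub_cancel, smul_pow, mul_smul_comm]
    match_scalars <;>
    · simp only [div_pow, ← pow_mul]
      field_simp
      ring

end Radial

/-! ### Wedge products with positive closed currents -/

section Wedge

variable {n p : ℕ} {Ω : Opens (H n)} {T : Current Ω (2 * p)}

theorem exists_isMeasureOf_wedge (hT : IsPositiveCurrent T) {U : Opens (H n)} (hU : U ≤ Ω)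
    {ψ : H n → Lam n} (hψ : IsSmoothForm U (2 * p) ψ) (hcone : ∀ q ∈ U, ψ q ∈ spCone n p) :
    ∃ μ, IsMeasureOf (wedge T hU hψ) μ := by
  let S : 𝓓(U, ℂ) →ₗ[ℂ] ℂ :=
    { toFun := wedge T hU hψ
      map_add' := fun φ χ => by
        rw [wedge, wedge, wedge, ← map_add]
        congr 1
        ext q
        exact add_smul (φ q) (χ q) (ψ q)
      map_smul' := fun c φ => by
        rw [wedge, wedge, RingHom.id_apply, ← map_smul]
        congr 1
        ext q
        exact mul_smul c (φ q) (ψ q) }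
  refine exists_isMeasureOf S fun φ hφ => hT _ fun q => ?_
  change realTest U φ q • ψ q ∈ spCone n p
  rw [realTest_apply, Complex.coe_smul]
  by_cases hq : q ∈ U
  · exact (spCone n p).smul_mem (hφ q) (hcone q hq)
  · rw [testFunction_eq_zero_of_notMem φ hq, zero_smul]
    exact (spCone n p).zero_mem

theorem exists_isMeasureOf_wedgeBeta (hT : IsPositiveCurrent T) :
    ∃ μ, IsMeasureOf (wedgeBeta T) μ :=
  exists_isMeasureOf_wedge hT le_rfl _ fun _ _ => pow_mem_spCone beta_mem_spCone p

theorem baston_kernel_mem_spCone {a q : H n} (hq : q ≠ a) : baston (kernel a) q ∈ spCone n 1 := by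
  rw [baston_kernel hq, ← sum_normSq_conjRow]
  exact (spCone n 1).smul_mem (by positivity) (sum_normSq_smul_beta_sub_theta_mem_spCone _)

theorem exists_isMeasureOf_wedgeKernel (hT : IsPositiveCurrent T) (a : H n) :
    ∃ μ, IsMeasureOf (wedgeKernel T a) μ :=
  exists_isMeasureOf_wedge hT _ _ fun _ hq => pow_mem_spCone (baston_kernel_mem_spCone hq.2) p

theorem contDiff_comp_norm_sub_sq {F : ℝ → ℝ} (hF : ContDiff ℝ ∞ F) (a : H n) :
    ContDiff ℝ ∞ fun q => F (‖q - a‖ ^ 2) :=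
  hF.comp ((contDiff_id.sub contDiff_const).norm_sq ℝ)

theorem contDiff_radial_smul_conjPullback_mul {F : ℝ → ℝ} (hF : ContDiff ℝ ∞ F) (s : Fin 2)
    (a : H n) (w : Lam n) :
    ContDiff ℝ ∞ fun q => F (‖q - a‖ ^ 2) • (conjPullback s (q - a) * w) := by
  have hlin : ContDiff ℝ ∞ fun q => conjPullback s (q - a) :=
    (LinearMap.toContinuousLinearMap (conjPullback s)).contDiff.comp
      (contDiff_id.sub contDiff_const)
  exact (contDiff_comp_norm_sub_sq hF a).smul
    (contDiffOn_univ.1 (contDiffOn_mul hlin.contDiffOn contDiffOn_const))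

theorem tsupport_subset_of_eq_zero {X M : Type*} [TopologicalSpace X] [T2Space X] [Zero M]
    {f : X → M} {K : Set X} (hK : IsCompact K) (hf : ∀ q ∉ K, f q = 0) : tsupport f ⊆ K :=
  closure_minimal (fun q hq => not_not.1 fun hqK => hq (hf q hqK)) hK.isClosed

/-- Up to the factor `p`, the test form is `d₀` of `F(‖q - a‖²) η ∧ β_n^{p-1}`, where
`2η = d₁‖q - a‖²`. -/
theorem exists_testForm_radial (hT : IsClosedCurrent T) {F : ℝ → ℝ} (hF : ContDiff ℝ ∞ F)
    {a : H n} {K : Set (H n)} (hK : IsCompact K) (hKΩ : K ⊆ Ω)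
    (hFK : ∀ q ∉ K, F (‖q - a‖ ^ 2) = 0) :
    ∃ ζ : TestForm Ω (2 * p), T ζ = 0 ∧ ∀ q, (ζ q : Lam n) =
      p • ((2 * deriv F (‖q - a‖ ^ 2)) • (theta (conjRow (q - a)) * beta n ^ (p - 1)) +
        (4 * F (‖q - a‖ ^ 2)) • beta n ^ p) := by
  rcases p with _ | k
  · exact ⟨0, map_zero T, fun q => by simp⟩
  let E : H n → Lam n := fun q => F (‖q - a‖ ^ 2) • (conjPullback 1 (q - a) * beta n ^ k)
  have hE0 : ∀ q ∉ K, E q = 0 := fun q hq => by simp only [E, hFK q hq, zero_smul]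
  have hdeg : ∀ q, E q ∈ deg n (1 + 2 * k) := fun q =>
    ((deg n _).restrictScalars ℝ).smul_mem _ (mul_mem_deg (conjPullback_mem 1 _)
      ((isSmoothForm_beta_pow univ k).2 q trivial))
  let η : TestForm Ω (1 + 2 * k) := mkTestForm E (contDiff_radial_smul_conjPullback_mul hF 1 a _)
    (HasCompactSupport.intro hK hE0) ((tsupport_subset_of_eq_zero hK hE0).trans hKΩ) hdeg
  have hk : 1 + 2 * k + 1 = 2 * (k + 1) := by ring
  refine ⟨(k + 1) • dTest 0 hk η, ?_, fun q => ?_⟩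
  · rw [map_nsmul, neg_eq_zero.1 (hT 0 _ hk η), smul_zero]
  have hd : d 0 E q = (2 * deriv F (‖q - a‖ ^ 2)) • (theta (conjRow (q - a)) * beta n ^ k) +
      (4 * F (‖q - a‖ ^ 2)) • beta n ^ (k + 1) := by
    rw [d_radial_smul (hF.differentiable (by simp) _).hasDerivAt
      (hasFDerivAt_conjPullback_mul 1 a q _).differentiableAt, d_conjPullback_mul, ← mul_assoc,
      conjPullback_zero_mul_one, ← pow_succ', smul_smul, mul_comm _ (4 : ℝ)]
  exact congrArg ((k + 1) • ·) hd

theorem wedgeKernel_eq_of_radial (hT : IsClosedCurrent T) {F : ℝ → ℝ} (hF : ContDiff ℝ ∞ F)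
    {a : H n} {K : Set (H n)} (hK : IsCompact K) (hKΩ : K ⊆ Ω)
    (hFK : ∀ q ∉ K, F (‖q - a‖ ^ 2) = 0) {φ : 𝓓(puncture Ω a, ℂ)} {ψ : 𝓓(Ω, ℂ)}
    (hφ : ∀ q, φ q = ((deriv F (‖q - a‖ ^ 2) * (‖q - a‖ ^ 2) ^ (2 * p + 1) : ℝ) : ℂ))
    (hψ : ∀ q, ψ q =
      ((2 * p * F (‖q - a‖ ^ 2) + ‖q - a‖ ^ 2 * deriv F (‖q - a‖ ^ 2) : ℝ) : ℂ)) :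
    wedgeKernel T a φ = 8 ^ p * wedgeBeta T ψ := by
  obtain ⟨ζ, hTζ, hζ⟩ := exists_testForm_radial hT hF hK hKΩ hFK
  have hforms : smulForm (puncture_le Ω a)
      (isSmoothForm_baston_pow (puncture Ω a).isOpen (contDiffOn_kernel Ω a) p) φ =
      (8 ^ p : ℂ) • smulForm le_rfl (isSmoothForm_beta_pow (Ω : Set (H n)) p) ψ -
        (8 ^ p / 2 : ℂ) • ζ := by
    ext q
    change φ q • baston (kernel a) q ^ p =
      (8 ^ p : ℂ) • (ψ q • beta n ^ p) - (8 ^ p / 2 : ℂ) • (ζ q : Lam n)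
    rw [hφ, hψ, hζ, Complex.coe_smul, Complex.coe_smul, mul_smul, pow_smul_baston_kernel_pow]
    match_scalars <;> ring
  rw [wedgeKernel, wedge, hforms, map_sub, map_smul, map_smul, hTζ, smul_zero, sub_zero,
    smul_eq_mul]
  rfl

end Wedge

/-! ### The radial transform -/

section RadialTransform

/-- The primitive of `φ(t) / t^{2p+1}` that vanishes at `s`. -/
def radialPrimitive (p : ℕ) (s : ℝ) (φ : ℝ → ℝ) (t : ℝ) : ℝ := ∫ τ in s..t, φ τ / τ ^ (2 * p + 1)

/-- The transform `2p F + t F'` of `φ`, where `F' = φ / t^{2p+1}` and `F(s) = 0`. It is chosen so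
that, up to the factor `8^p`, integrating `φ(‖q - a‖²)` against `T ∧ (△(-‖q - a‖⁻²))^p` amounts to
integrating its transform against `T ∧ β_n^p`. -/
def radialTransform (p : ℕ) (s : ℝ) (φ : ℝ → ℝ) (t : ℝ) : ℝ :=
  2 * p * radialPrimitive p s φ t + t * (φ t / t ^ (2 * p + 1))

variable {p : ℕ} {c s : ℝ} {φ : ℝ → ℝ}

theorem contDiff_div_pow (hφ : ContDiff ℝ ∞ φ) (hc : 0 < c) (hφ0 : ∀ t ∉ Ioo c s, φ t = 0)
    (m : ℕ) : ContDiff ℝ ∞ fun t => φ t / t ^ m := by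
  refine contDiff_iff_contDiffAt.2 fun t => ?_
  rcases lt_or_ge t c with ht | ht
  · have hzero : (fun t => φ t / t ^ m) =ᶠ[𝓝 t] fun _ => 0 := by
      filter_upwards [Iio_mem_nhds ht] with y hy
      rw [hφ0 y fun h => lt_asymm hy h.1, zero_div]
    exact contDiffAt_const.congr_of_eventuallyEq hzero
  · exact hφ.contDiffAt.div (contDiff_id.pow m).contDiffAt (pow_ne_zero m (hc.trans_le ht).ne')

theorem hasDerivAt_radialPrimitive (hφ : ContDiff ℝ ∞ φ) (hc : 0 < c)
    (hφ0 : ∀ t ∉ Ioo c s, φ t = 0) (t : ℝ) :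
    HasDerivAt (radialPrimitive p s φ) (φ t / t ^ (2 * p + 1)) t :=
  ((contDiff_div_pow hφ hc hφ0 _).continuous.integral_hasStrictDerivAt s t).hasDerivAt

theorem contDiff_radialPrimitive (hφ : ContDiff ℝ ∞ φ) (hc : 0 < c)
    (hφ0 : ∀ t ∉ Ioo c s, φ t = 0) : ContDiff ℝ ∞ (radialPrimitive p s φ) := by
  have hd : deriv (radialPrimitive p s φ) = fun t => φ t / t ^ (2 * p + 1) :=
    funext fun t => (hasDerivAt_radialPrimitive hφ hc hφ0 t).deriv
  rw [contDiff_infty_iff_deriv, hd]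
  exact ⟨fun t => (hasDerivAt_radialPrimitive hφ hc hφ0 t).differentiableAt,
    contDiff_div_pow hφ hc hφ0 _⟩

theorem contDiff_radialTransform (hφ : ContDiff ℝ ∞ φ) (hc : 0 < c)
    (hφ0 : ∀ t ∉ Ioo c s, φ t = 0) : ContDiff ℝ ∞ (radialTransform p s φ) :=
  (contDiff_const.mul (contDiff_radialPrimitive hφ hc hφ0)).add
    (contDiff_id.mul (contDiff_div_pow hφ hc hφ0 _))

theorem radialPrimitive_eq_zero (hφ0 : ∀ t ∉ Ioo c s, φ t = 0) {t : ℝ} (ht : s ≤ t) :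
    radialPrimitive p s φ t = 0 := by
  refine intervalIntegral.integral_zero_ae (Eventually.of_forall fun τ hτ => ?_)
  rw [uIoc_of_le ht] at hτ
  rw [hφ0 τ fun h => lt_asymm hτ.1 h.2, zero_div]

theorem radialTransform_eq_zero (hφ0 : ∀ t ∉ Ioo c s, φ t = 0) {t : ℝ} (ht : s ≤ t) :
    radialTransform p s φ t = 0 := by
  rw [radialTransform, radialPrimitive_eq_zero hφ0 ht, hφ0 t fun h => h.2.not_ge ht, zero_div,
    mul_zero, mul_zero, add_zero]

theorem norm_div_pow_le (hc : 0 < c) (hφ0 : ∀ t ∉ Ioo c s, φ t = 0) (hφ1 : ∀ t, |φ t| ≤ 1)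
    (m : ℕ) (t : ℝ) : ‖φ t / t ^ m‖ ≤ 1 / c ^ m := by
  by_cases ht : t ∈ Ioo c s
  · rw [Real.norm_eq_abs, abs_div, abs_of_pos (pow_pos (hc.trans ht.1) m)]
    exact div_le_div₀ zero_le_one (hφ1 t) (pow_pos hc m) (pow_le_pow_left₀ hc.le ht.1.le m)
  · rw [hφ0 t ht, zero_div, norm_zero]
    positivity

theorem norm_radialTransform_le (hc : 0 < c) (hφ0 : ∀ t ∉ Ioo c s, φ t = 0)
    (hφ1 : ∀ t, |φ t| ≤ 1) {t : ℝ} (ht : 0 ≤ t) :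
    ‖radialTransform p s φ t‖ ≤
      (Iio s).indicator (fun _ => (2 * p + 1) * (1 / c ^ (2 * p + 1) * s)) t := by
  rcases lt_or_ge t s with hts | hts
  · have hs : 0 ≤ s := ht.trans hts.le
    have hprim : ‖radialPrimitive p s φ t‖ ≤ 1 / c ^ (2 * p + 1) * s :=
      (intervalIntegral.norm_integral_le_of_norm_le_const fun τ _ =>
        norm_div_pow_le hc hφ0 hφ1 _ τ).trans
        (mul_le_mul_of_nonneg_left (by rw [abs_le]; constructor <;> linarith) (by positivity))
    rw [indicator_of_mem (mem_Iio.2 hts)]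
    calc ‖radialTransform p s φ t‖
        ≤ 2 * p * ‖radialPrimitive p s φ t‖ + t * ‖φ t / t ^ (2 * p + 1)‖ := by
          refine (norm_add_le _ _).trans (add_le_add ?_ ?_)
          · rw [norm_mul, Real.norm_of_nonneg (by positivity)]
          · rw [norm_mul, Real.norm_of_nonneg ht]
      _ ≤ 2 * p * (1 / c ^ (2 * p + 1) * s) + s * (1 / c ^ (2 * p + 1)) := by
          gcongr
          exact norm_div_pow_le hc hφ0 hφ1 _ t
      _ = (2 * p + 1) * (1 / c ^ (2 * p + 1) * s) := by ring
  · rw [radialTransform_eq_zero hφ0 hts, norm_zero, indicator_of_notMem (notMem_Iio.2 hts)]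

theorem integral_one_div_pow {m : ℝ} (hm : 0 < m) (hms : m ≤ s) :
    2 * p * ∫ τ in m..s, 1 / τ ^ (2 * p + 1) = 1 / m ^ (2 * p) - 1 / s ^ (2 * p) := by
  have hne : ∀ τ ∈ uIcc m s, τ ≠ 0 := fun τ hτ => by
    rw [uIcc_of_le hms] at hτ
    exact (hm.trans_le hτ.1).ne'
  have hderiv : ∀ τ ∈ uIcc m s,
      HasDerivAt (fun τ : ℝ => -(τ ^ (2 * p))⁻¹) (2 * p * (1 / τ ^ (2 * p + 1))) τ := by
    intro τ hτ
    have h0 := hne τ hτ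
    refine ((hasDerivAt_pow (2 * p) τ).inv (pow_ne_zero _ h0)).neg.congr_deriv ?_
    rcases p with _ | p
    · simp
    · rw [show 2 * (p + 1) - 1 = 2 * p + 1 by omega]
      push_cast
      field_simp
      ring
  have hcont : ContinuousOn (fun τ : ℝ => 2 * p * (1 / τ ^ (2 * p + 1))) (uIcc m s) :=
    continuousOn_const.mul (continuousOn_const.div (continuous_id.pow _).continuousOn
      fun τ hτ => pow_ne_zero _ (hne τ hτ))
  rw [← intervalIntegral.integral_const_mul,
    intervalIntegral.integral_eq_sub_of_hasDerivAt hderiv hcont.intervalIntegrable]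
  ring

/-- A sequence of smooth functions with values in `[0, 1]`, supported in `[c, s]`, which converges
pointwise to the indicator function of `(c, s)`. -/
def intervalCutoff (c s : ℝ) (j : ℕ) (t : ℝ) : ℝ :=
  Real.smoothTransition (j * ((t - c) * (s - t)))

theorem contDiff_intervalCutoff (c s : ℝ) (j : ℕ) : ContDiff ℝ ∞ (intervalCutoff c s j) :=
  (Real.smoothTransition.contDiff (n := ⊤)).comp (by fun_prop)

theorem abs_intervalCutoff_le_one (c s : ℝ) (j : ℕ) (t : ℝ) : |intervalCutoff c s j t| ≤ 1 := by
  rw [intervalCutoff, abs_of_nonneg (Real.smoothTransition.nonneg _)]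
  exact Real.smoothTransition.le_one _

theorem intervalCutoff_eq_zero (hcs : c ≤ s) (j : ℕ) (t : ℝ) (ht : t ∉ Ioo c s) :
    intervalCutoff c s j t = 0 := by
  refine Real.smoothTransition.zero_of_nonpos
    (mul_nonpos_of_nonneg_of_nonpos j.cast_nonneg ?_)
  rcases le_or_gt t c with htc | htc
  · exact mul_nonpos_of_nonpos_of_nonneg (by linarith) (by linarith)
  · have hst : s ≤ t := not_lt.1 fun h => ht ⟨htc, h⟩
    exact mul_nonpos_of_nonneg_of_nonpos (by linarith) (by linarith)

theorem abs_intervalCutoff_le_indicator (hcs : c ≤ s) (j : ℕ) (t : ℝ) :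
    |intervalCutoff c s j t| ≤ (Ioo c s).indicator 1 t := by
  by_cases ht : t ∈ Ioo c s
  · rw [indicator_of_mem ht]
    exact abs_intervalCutoff_le_one c s j t
  · rw [indicator_of_notMem ht, intervalCutoff_eq_zero hcs j t ht, abs_zero]

theorem tendsto_intervalCutoff (hcs : c ≤ s) (t : ℝ) :
    Tendsto (fun j => intervalCutoff c s j t) atTop (𝓝 ((Ioo c s).indicator 1 t)) := by
  by_cases ht : t ∈ Ioo c s
  · have hpos : 0 < (t - c) * (s - t) := mul_pos (sub_pos.2 ht.1) (sub_pos.2 ht.2)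
    rw [indicator_of_mem ht]
    refine tendsto_const_nhds.congr' ?_
    filter_upwards [(tendsto_natCast_atTop_atTop.atTop_mul_const hpos).eventually_ge_atTop 1]
      with j hj
    exact (Real.smoothTransition.one_of_one_le hj).symm
  · rw [indicator_of_notMem ht]
    simp only [intervalCutoff_eq_zero hcs _ t ht, tendsto_const_nhds]

theorem radialPrimitive_indicator_Ioo (hc : 0 < c) (hcs : c ≤ s) {t : ℝ} (hts : t ≤ s) :
    2 * p * radialPrimitive p s ((Ioo c s).indicator 1) t =
      1 / s ^ (2 * p) - 1 / max t c ^ (2 * p) := by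
  have hind : (fun τ => (Ioo c s).indicator 1 τ / τ ^ (2 * p + 1)) =
      (Ioo c s).indicator fun τ => 1 / τ ^ (2 * p + 1) := by
    funext τ
    by_cases hτ : τ ∈ Ioo c s <;> simp [hτ]
  rw [radialPrimitive, intervalIntegral.integral_symm, hind, intervalIntegral.integral_of_le hts,
    setIntegral_indicator measurableSet_Ioo, Ioc_inter_Ioo_of_right_le le_rfl,
    ← integral_Ioc_eq_integral_Ioo, ← intervalIntegral.integral_of_le (max_le hts hcs), mul_neg,
    integral_one_div_pow (lt_max_of_lt_right hc) (max_le hts hcs), neg_sub]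

theorem tendsto_radialTransform_intervalCutoff (hc : 0 < c) (hcs : c < s) (t : ℝ) :
    Tendsto (fun j => radialTransform p s (intervalCutoff c s j) t) atTop
      (𝓝 ((Iio s).indicator (fun _ => 1 / s ^ (2 * p)) t -
        (Iic c).indicator (fun _ => 1 / c ^ (2 * p)) t)) := by
  have hprim : Tendsto (fun j => radialPrimitive p s (intervalCutoff c s j) t) atTop
      (𝓝 (radialPrimitive p s ((Ioo c s).indicator 1) t)) :=
    intervalIntegral.tendsto_integral_filter_of_dominated_convergence
      (fun _ => 1 / c ^ (2 * p + 1))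
      (Eventually.of_forall fun j => (contDiff_div_pow (contDiff_intervalCutoff c s j) hc
        (intervalCutoff_eq_zero hcs.le j) _).continuous.aestronglyMeasurable)
      (Eventually.of_forall fun j => Eventually.of_forall fun τ _ => norm_div_pow_le hc
        (intervalCutoff_eq_zero hcs.le j) (abs_intervalCutoff_le_one c s j) _ τ)
      intervalIntegrable_const
      (Eventually.of_forall fun τ _ => (tendsto_intervalCutoff hcs.le τ).div_const _)
  have hlim : Tendsto (fun j => radialTransform p s (intervalCutoff c s j) t) atTop
      (𝓝 (radialTransform p s ((Ioo c s).indicator 1) t)) :=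
    (hprim.const_mul _).add (((tendsto_intervalCutoff hcs.le t).div_const _).const_mul t)
  convert hlim using 2
  rcases lt_or_ge t s with hts | hts
  · rw [indicator_of_mem (mem_Iio.2 hts), radialTransform, radialPrimitive_indicator_Ioo hc hcs.le
      hts.le]
    rcases le_or_gt t c with htc | htc
    · rw [indicator_of_mem (mem_Iic.2 htc), indicator_of_notMem fun h => h.1.not_ge htc,
        max_eq_right htc, zero_div, mul_zero, add_zero]
    · have ht0 : t ≠ 0 := (hc.trans htc).ne'
      rw [indicator_of_notMem (notMem_Iic.2 htc), indicator_of_mem (mem_Ioo.2 ⟨htc, hts⟩),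
        max_eq_left htc.le, Pi.one_apply]
      field_simp
      ring
  · rw [indicator_of_notMem (notMem_Iio.2 hts), indicator_of_notMem
      (notMem_Iic.2 (hcs.trans_le hts)), sub_zero, radialTransform_eq_zero
      (fun _ h => indicator_of_notMem h _) hts]

end RadialTransform

/-! ### The mass of shells -/

section RadialLimits

variable {E : Type*} [NormedAddCommGroup E] {a : E} {r r₁ r₂ : ℝ}

theorem preimage_sq_norm_sub_Iio (a : E) (hr : 0 ≤ r) :
    (fun q => ‖q - a‖ ^ 2) ⁻¹' Iio (r ^ 2) = ball a r := by
  ext q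
  rw [mem_ball_iff_norm]
  exact pow_lt_pow_iff_left₀ (norm_nonneg _) hr two_ne_zero

theorem preimage_sq_norm_sub_Iic (a : E) (hr : 0 ≤ r) :
    (fun q => ‖q - a‖ ^ 2) ⁻¹' Iic (r ^ 2) = closedBall a r := by
  ext q
  rw [mem_closedBall_iff_norm]
  exact pow_le_pow_iff_left₀ (norm_nonneg _) hr two_ne_zero

theorem preimage_sq_norm_sub_Ioo (a : E) (h₁ : 0 ≤ r₁) (h₂ : 0 ≤ r₂) :
    (fun q => ‖q - a‖ ^ 2) ⁻¹' Ioo (r₁ ^ 2) (r₂ ^ 2) = ball a r₂ \ closedBall a r₁ := by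
  rw [← preimage_sq_norm_sub_Iio a h₂, ← preimage_sq_norm_sub_Iic a h₁, ← preimage_sdiff,
    sdiff_eq, compl_Iic, inter_comm, Ioi_inter_Iio]

variable [MeasurableSpace E] [BorelSpace E] {μ : Measure E}

theorem tendsto_integral_intervalCutoff (hμ : μ (ball a r₂ \ closedBall a r₁) ≠ ⊤) (h₁ : 0 ≤ r₁)
    (h₁₂ : r₁ ≤ r₂) :
    Tendsto (fun j => ∫ q, intervalCutoff (r₁ ^ 2) (r₂ ^ 2) j (‖q - a‖ ^ 2) ∂μ) atTop
      (𝓝 (μ.real (ball a r₂ \ closedBall a r₁))) := by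
  have hsq : r₁ ^ 2 ≤ r₂ ^ 2 := pow_le_pow_left₀ h₁ h₁₂ 2
  have hmeas : MeasurableSet (ball a r₂ \ closedBall a r₁) :=
    measurableSet_ball.diff measurableSet_closedBall
  rw [← integral_indicator_one hmeas]
  refine tendsto_integral_of_dominated_convergence ((ball a r₂ \ closedBall a r₁).indicator 1)
    (fun j => Continuous.aestronglyMeasurable ((contDiff_intervalCutoff _ _ j).continuous.comp
      (by fun_prop)))
    ((integrable_indicator_iff hmeas).2 (integrableOn_const hμ))
    (fun j => Eventually.of_forall fun q => ?_) (Eventually.of_forall fun q => ?_)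
  all_goals rw [← preimage_sq_norm_sub_Ioo a h₁ (h₁.trans h₁₂)]
  · exact abs_intervalCutoff_le_indicator hsq j (‖q - a‖ ^ 2)
  · exact tendsto_intervalCutoff hsq (‖q - a‖ ^ 2)

theorem tendsto_integral_radialTransform (p : ℕ) (hμ : μ (ball a r₂) ≠ ⊤) (h₁ : 0 < r₁)
    (h₁₂ : r₁ < r₂) :
    Tendsto (fun j => ∫ q, radialTransform p (r₂ ^ 2) (intervalCutoff (r₁ ^ 2) (r₂ ^ 2) j)
        (‖q - a‖ ^ 2) ∂μ) atTop
      (𝓝 (μ.real (ball a r₂) / r₂ ^ (4 * p) - μ.real (closedBall a r₁) / r₁ ^ (4 * p))) := by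
  have h₂ : 0 < r₂ := h₁.trans h₁₂
  have hsq : r₁ ^ 2 < r₂ ^ 2 := pow_lt_pow_left₀ h₁₂ h₁.le two_ne_zero
  have hint (x : ℝ) : Integrable ((ball a r₂).indicator fun _ => x) μ :=
    (integrable_indicator_iff measurableSet_ball).2 (integrableOn_const hμ)
  have hint' (x : ℝ) : Integrable ((closedBall a r₁).indicator fun _ => x) μ :=
    (integrable_indicator_iff measurableSet_closedBall).2
      (integrableOn_const (measure_ne_top_of_subset (closedBall_subset_ball h₁₂) hμ))
  have hlim : μ.real (ball a r₂) / r₂ ^ (4 * p) - μ.real (closedBall a r₁) / r₁ ^ (4 * p) =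
      ∫ q, (ball a r₂).indicator (fun _ => 1 / (r₂ ^ 2) ^ (2 * p)) q -
        (closedBall a r₁).indicator (fun _ => 1 / (r₁ ^ 2) ^ (2 * p)) q ∂μ := by
    rw [integral_sub (hint _) (hint' _), integral_indicator_const _ measurableSet_ball,
      integral_indicator_const _ measurableSet_closedBall, smul_eq_mul, smul_eq_mul, mul_one_div,
      mul_one_div, ← pow_mul, ← pow_mul, show 2 * (2 * p) = 4 * p by ring]
  rw [hlim]
  refine tendsto_integral_of_dominated_convergence _
    (fun j => Continuous.aestronglyMeasurable ((contDiff_radialTransform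
      (contDiff_intervalCutoff _ _ j) (pow_pos h₁ 2)
      (intervalCutoff_eq_zero hsq.le j)).continuous.comp (by fun_prop)))
    (hint ((2 * p + 1) * (1 / (r₁ ^ 2) ^ (2 * p + 1) * r₂ ^ 2)))
    (fun j => Eventually.of_forall fun q => ?_) (Eventually.of_forall fun q => ?_)
  · rw [← preimage_sq_norm_sub_Iio a h₂.le]
    exact norm_radialTransform_le (pow_pos h₁ 2) (intervalCutoff_eq_zero hsq.le j)
      (abs_intervalCutoff_le_one _ _ j) (sq_nonneg ‖q - a‖)
  · rw [← preimage_sq_norm_sub_Iio a h₂.le, ← preimage_sq_norm_sub_Iic a h₁.le]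
    exact tendsto_radialTransform_intervalCutoff (pow_pos h₁ 2) hsq (‖q - a‖ ^ 2)

end RadialLimits

section Shell

variable {n p : ℕ} {Ω : Opens (H n)} {T : Current Ω (2 * p)} {a : H n} {r₁ r₂ : ℝ}

/-- The test function `f(‖q - a‖²)` on `U`; the compact set `K` witnesses that its support lies in
`U`. -/
def radialTest {U : Opens (H n)} (a : H n) {f : ℝ → ℝ} (hf : ContDiff ℝ ∞ f) {K : Set (H n)}
    (hK : IsCompact K) (hKU : K ⊆ U) (hfK : ∀ q ∉ K, f (‖q - a‖ ^ 2) = 0) : 𝓓(U, ℂ) where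
  toFun q := ((f (‖q - a‖ ^ 2) : ℝ) : ℂ)
  contDiff' := Complex.ofRealCLM.contDiff.comp (contDiff_comp_norm_sub_sq hf a)
  hasCompactSupport' := HasCompactSupport.intro hK fun q hq => by rw [hfK q hq, Complex.ofReal_zero]
  tsupport_subset' := (tsupport_subset_of_eq_zero hK fun q hq => by
    rw [hfK q hq, Complex.ofReal_zero]).trans hKU

theorem closedBall_diff_ball_subset_puncture (h₁ : 0 < r₁) (hr₂ : closedBall a r₂ ⊆ Ω) :
    closedBall a r₂ \ ball a r₁ ⊆ puncture Ω a := fun _ hq =>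
  ⟨hr₂ hq.1, fun h => hq.2 (h ▸ mem_ball_self h₁)⟩

theorem integral_radial_eq (hT : IsClosedCurrent T) {μ κ : Measure (H n)}
    (hμ : IsMeasureOf (wedgeBeta T) μ) (hκ : IsMeasureOf (wedgeKernel T a) κ) (h₁ : 0 < r₁)
    (h₂ : 0 ≤ r₂) (hr₂ : closedBall a r₂ ⊆ Ω) {φ : ℝ → ℝ} (hφ : ContDiff ℝ ∞ φ)
    (hφ0 : ∀ t ∉ Ioo (r₁ ^ 2) (r₂ ^ 2), φ t = 0) :
    ∫ q, φ (‖q - a‖ ^ 2) ∂κ = 8 ^ p * ∫ q, radialTransform p (r₂ ^ 2) φ (‖q - a‖ ^ 2) ∂μ := by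
  have hc : 0 < r₁ ^ 2 := pow_pos h₁ 2
  have hshell : ∀ q ∉ closedBall a r₂ \ ball a r₁, φ (‖q - a‖ ^ 2) = 0 := fun q hq =>
    hφ0 _ fun h => hq (sdiff_subset_sdiff ball_subset_closedBall ball_subset_closedBall
      ((preimage_sq_norm_sub_Ioo a h₁.le h₂).subset h))
  have hle : ∀ q ∉ closedBall a r₂, r₂ ^ 2 ≤ ‖q - a‖ ^ 2 := fun q hq =>
    (not_le.1 fun h => hq ((preimage_sq_norm_sub_Iic a h₂).subset h)).le
  have hderiv (t : ℝ) : deriv (radialPrimitive p (r₂ ^ 2) φ) t = φ t / t ^ (2 * p + 1) :=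
    (hasDerivAt_radialPrimitive hφ hc hφ0 t).deriv
  have hφ_eq (t : ℝ) :
      φ t = deriv (radialPrimitive p (r₂ ^ 2) φ) t * t ^ (2 * p + 1) := by
    rw [hderiv, div_mul_cancel_of_imp fun h => ?_]
    rw [eq_zero_of_pow_eq_zero h, hφ0 0 fun h0 => h0.1.not_gt hc]
  have key := wedgeKernel_eq_of_radial (a := a) hT (contDiff_radialPrimitive (p := p) hφ hc hφ0)
    (isCompact_closedBall a r₂) hr₂ (fun q hq => radialPrimitive_eq_zero hφ0 (hle q hq))
    (φ := radialTest a hφ ((isCompact_closedBall a r₂).diff isOpen_ball)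
      (closedBall_diff_ball_subset_puncture h₁ hr₂) hshell)
    (ψ := radialTest a (contDiff_radialTransform (p := p) hφ hc hφ0) (isCompact_closedBall a r₂)
      hr₂ fun q hq => radialTransform_eq_zero hφ0 (hle q hq))
    (fun q => congrArg Complex.ofReal (hφ_eq _))
    (fun q => congrArg Complex.ofReal (by rw [hderiv, radialTransform]))
  rw [hκ.2.2, hμ.2.2] at key
  change ∫ q, ((φ (‖q - a‖ ^ 2) : ℝ) : ℂ) ∂κ =
    8 ^ p * ∫ q, ((radialTransform p (r₂ ^ 2) φ (‖q - a‖ ^ 2) : ℝ) : ℂ) ∂μ at key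
  rw [integral_complex_ofReal, integral_complex_ofReal] at key
  exact_mod_cast key

theorem measure_ball_diff_closedBall_ne_top {S : 𝓓(puncture Ω a, ℂ) → ℂ} {κ : Measure (H n)}
    (hκ : IsMeasureOf S κ) (hr₂ : closedBall a r₂ ⊆ Ω) (h₁ : 0 < r₁) :
    κ (ball a r₂ \ closedBall a r₁) ≠ ⊤ :=
  measure_ne_top_of_subset (sdiff_subset_sdiff ball_subset_closedBall ball_subset_closedBall)
    (hκ.2.1 _ ((isCompact_closedBall a r₂).diff isOpen_ball)
      (closedBall_diff_ball_subset_puncture h₁ hr₂)).ne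

theorem measureReal_ball_diff_closedBall (hT : IsClosedCurrent T) {μ κ : Measure (H n)}
    (hμ : IsMeasureOf (wedgeBeta T) μ) (hκ : IsMeasureOf (wedgeKernel T a) κ)
    (hr₂ : closedBall a r₂ ⊆ Ω) (h₁ : 0 < r₁) (h₁₂ : r₁ < r₂) :
    κ.real (ball a r₂ \ closedBall a r₁) =
      8 ^ p * (μ.real (ball a r₂) / r₂ ^ (4 * p) - μ.real (closedBall a r₁) / r₁ ^ (4 * p)) := by
  have hμr : μ (ball a r₂) ≠ ⊤ :=
    measure_ne_top_of_subset ball_subset_closedBall (hμ.2.1 _ (isCompact_closedBall a r₂) hr₂).ne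
  refine tendsto_nhds_unique (tendsto_integral_intervalCutoff
    (measure_ball_diff_closedBall_ne_top hκ hr₂ h₁) h₁.le h₁₂.le)
    (((tendsto_integral_radialTransform p hμr h₁ h₁₂).const_mul (8 ^ p)).congr fun j => ?_)
  exact (integral_radial_eq hT hμ hκ h₁ (h₁.trans h₁₂).le hr₂ (contDiff_intervalCutoff _ _ j)
    (intervalCutoff_eq_zero (pow_le_pow_left₀ h₁.le h₁₂.le 2) j)).symm

theorem measureReal_ball_diff_ball (hT : IsClosedCurrent T) {μ κ : Measure (H n)}
    (hμ : IsMeasureOf (wedgeBeta T) μ) (hκ : IsMeasureOf (wedgeKernel T a) κ)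
    (hr₂ : closedBall a r₂ ⊆ Ω) (h₁ : 0 < r₁) (h₁₂ : r₁ < r₂) :
    κ.real (ball a r₂ \ ball a r₁) =
      8 ^ p * (μ.real (ball a r₂) / r₂ ^ (4 * p) - μ.real (ball a r₁) / r₁ ^ (4 * p)) := by
  have hc : 0 < r₁ / 2 := half_pos h₁
  have hcr : r₁ / 2 < r₁ := half_lt_self h₁
  have hshell : ball a r₂ \ ball a r₁ =
      (ball a r₂ \ closedBall a (r₁ / 2)) \ (ball a r₁ \ closedBall a (r₁ / 2)) := by
    rw [sdiff_sdiff_sdiff_cancel_right (closedBall_subset_ball hcr)]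
  rw [hshell, measureReal_sdiff (sdiff_subset_sdiff_left (ball_subset_ball h₁₂.le))
      (measurableSet_ball.diff measurableSet_closedBall)
      (measure_ball_diff_closedBall_ne_top hκ hr₂ hc),
    measureReal_ball_diff_closedBall hT hμ hκ hr₂ hc (hcr.trans h₁₂),
    measureReal_ball_diff_closedBall hT hμ hκ ((closedBall_subset_closedBall h₁₂.le).trans hr₂) hc
      hcr]
  ring

theorem isMeasureOf_measureOf {U : Opens (H n)} {S : 𝓓(U, ℂ) → ℂ} (h : ∃ μ, IsMeasureOf S μ) :
    IsMeasureOf S (measureOf S) := by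
  rw [measureOf, dif_pos h]
  exact h.choose_spec

theorem integralOn_wedgeKernel_ball_diff_ball (hpos : IsPositiveCurrent T)
    (hT : IsClosedCurrent T) (hr₂ : closedBall a r₂ ⊆ Ω) (h₁ : 0 < r₁) (h₁₂ : r₁ < r₂) :
    integralOn (wedgeKernel T a) (ball a r₂ \ ball a r₁) =
      8 ^ p * (sigma T a r₂ / r₂ ^ (4 * p) - sigma T a r₁ / r₁ ^ (4 * p)) :=
  measureReal_ball_diff_ball hT (isMeasureOf_measureOf (exists_isMeasureOf_wedgeBeta hpos))
    (isMeasureOf_measureOf (exists_isMeasureOf_wedgeKernel hpos a)) hr₂ h₁ h₁₂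

theorem integralOn_wedgeKernel_ball_diff_closedBall (hpos : IsPositiveCurrent T)
    (hT : IsClosedCurrent T) (hr₂ : closedBall a r₂ ⊆ Ω) (h₁ : 0 < r₁) (h₁₂ : r₁ < r₂) :
    integralOn (wedgeKernel T a) (ball a r₂ \ closedBall a r₁) =
      8 ^ p * (sigma T a r₂ / r₂ ^ (4 * p) -
        integralOn (wedgeBeta T) (closedBall a r₁) / r₁ ^ (4 * p)) :=
  measureReal_ball_diff_closedBall hT (isMeasureOf_measureOf (exists_isMeasureOf_wedgeBeta hpos))
    (isMeasureOf_measureOf (exists_isMeasureOf_wedgeKernel hpos a)) hr₂ h₁ h₁₂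

variable {R : ℝ}

theorem monotoneOn_sigma_div (hpos : IsPositiveCurrent T) (hT : IsClosedCurrent T)
    (hR : ball a R ⊆ Ω) : MonotoneOn (fun r : ℝ => sigma T a r / r ^ (4 * p)) (Ioo 0 R) := by
  intro r₁ h₁ r₂ h₂ hle
  rcases hle.eq_or_lt with rfl | hlt
  · exact le_rfl
  have hmass := integralOn_wedgeKernel_ball_diff_ball hpos hT
    ((closedBall_subset_ball h₂.2).trans hR) h₁.1 hlt
  have hmass_nonneg : 0 ≤ integralOn (wedgeKernel T a) (ball a r₂ \ ball a r₁) :=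
    measureReal_nonneg
  rw [hmass] at hmass_nonneg
  exact sub_nonneg.1 (nonneg_of_mul_nonneg_right hmass_nonneg (by positivity))

theorem exists_isLelongNumber_nonneg (hpos : IsPositiveCurrent T) (hT : IsClosedCurrent T)
    (hR0 : 0 < R) (hR : ball a R ⊆ Ω) : ∃ ν : ℝ, IsLelongNumber T a ν ∧ 0 ≤ ν := by
  have hnonneg : ∀ r ∈ Ioo 0 R, 0 ≤ sigma T a r / r ^ (4 * p) := fun r hr =>
    div_nonneg measureReal_nonneg (pow_nonneg hr.1.le _)
  have hlim := (monotoneOn_sigma_div hpos hT hR).tendsto_nhdsWithin_Ioo_right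
    (nonempty_Ioo.2 hR0) ⟨0, forall_mem_image.2 hnonneg⟩
  exact ⟨_, hlim, ge_of_tendsto hlim (eventually_of_mem (Ioo_mem_nhdsGT hR0) hnonneg)⟩

end Shell

end QCurrent

end

theorem proposition4p3 {n p : ℕ} (hp : p ≤ n) (Ω : TopologicalSpace.Opens (QCurrent.H n))
    (a : QCurrent.H n) (R : ℝ) (hR : 0 < R) (hball : closure (ball a R) ⊆ (Ω : Set (QCurrent.H n)))
    (T : QCurrent.Current Ω (2 * p)) (hpos : QCurrent.IsPositiveCurrent T)
    (hclosed : QCurrent.IsClosedCurrent T) :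
    -- both `2n`-currents are given by positive Radon measures, so that the integrals make sense
    (∃ μ, QCurrent.IsMeasureOf (QCurrent.wedgeBeta T) μ) ∧
    (∃ μ, QCurrent.IsMeasureOf (QCurrent.wedgeKernel T a) μ) ∧
    -- the formula on the shells `r₁ ≤ ‖q - a‖ < r₂`
    (∀ r₁ r₂ : ℝ, 0 < r₁ → r₁ < r₂ → r₂ < R →
      QCurrent.integralOn (QCurrent.wedgeKernel T a) (ball a r₂ \ ball a r₁) =
        8 ^ p * (QCurrent.sigma T a r₂ / r₂ ^ (4 * p) - QCurrent.sigma T a r₁ / r₁ ^ (4 * p))) ∧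
    -- the formula on the shells `r₁ < ‖q - a‖ < r₂`
    (∀ r₁ r₂ : ℝ, 0 < r₁ → r₁ < r₂ → r₂ < R →
      QCurrent.integralOn (QCurrent.wedgeKernel T a) (ball a r₂ \ closedBall a r₁) =
        8 ^ p * (QCurrent.sigma T a r₂ / r₂ ^ (4 * p) -
          QCurrent.integralOn (QCurrent.wedgeBeta T) (closedBall a r₁) / r₁ ^ (4 * p))) ∧
    -- `r^{-4p} σ_T(a, r)` is increasing
    MonotoneOn (fun r : ℝ => QCurrent.sigma T a r / r ^ (4 * p)) (Ioo 0 R) ∧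
    -- the Lelong number exists and is nonnegative
    ∃ ν : ℝ, QCurrent.IsLelongNumber T a ν ∧ 0 ≤ ν := by
  have hΩ : ball a R ⊆ Ω := subset_closure.trans hball
  have hcl : ∀ r < R, closedBall a r ⊆ Ω := fun r hr => (closedBall_subset_ball hr).trans hΩ
  exact ⟨QCurrent.exists_isMeasureOf_wedgeBeta hpos,
    QCurrent.exists_isMeasureOf_wedgeKernel hpos a,
    fun r₁ r₂ h₁ h₁₂ h₂ =>
      QCurrent.integralOn_wedgeKernel_ball_diff_ball hpos hclosed (hcl r₂ h₂) h₁ h₁₂,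
    fun r₁ r₂ h₁ h₁₂ h₂ =>
      QCurrent.integralOn_wedgeKernel_ball_diff_closedBall hpos hclosed (hcl r₂ h₂) h₁ h₁₂,
    QCurrent.monotoneOn_sigma_div hpos hclosed hΩ,
    QCurrent.exists_isLelongNumber_nonneg hpos hclosed hR hΩ⟩
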